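/- All Lie algebras are over $\mathbb{C}$. **Structure constants.** Let $\mathfrak g$ be a Lie algebra with an $\mathfrak{sl}_2$-triple $(E,H,F)$ ($[E,F]=H$, $[H,E]=2E$, $[H,F]=-2F$), decomposed as $\mathfrak g=\bigoplus_{a\in I}V_a$ into irreducible $\mathfrak{sl}_2$-modules with $\dim V_a=2d_a+1$ and with chosen highest weight vectors $v_a\in V_a$, so that the vectors $G_{a,p}=\mathrm{ad}_F^{\,p}(v_a)$, $0\le p\le 2d_a$, form a basis of $\mathfrak g$. Attach to $G_{a,p}$ the monomial $y^{p}x^{2d_a-p}/(2d_a-p)!$. The $m$-th transvectant of $P,Q\in\mathbb C[x,y]$ is obtained by applying $\Omega^m$ to $P\otimes Q$, where $\Omega=\partial_x\otimes\partial_y-\partial_y\otimes\partial_x$, and then multiplying. The structure constants $\omega_{a,b}^{c}$ $(a,b,c\in I)$ are the numbers such that for all $a,b,p,q$ the $V_c$-component of $[G_{a,p},G_{b,q}]$ corresponds to $\omega_{a,b}^{c}$ times the transvectant of order $d_a+d_b-d_c$ of the monomials of $G_{a,p}$ and $G_{b,q}$; if $V_c$ does not occur in $V_a\otimes V_b$ (i.e.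 $d_a,d_b,d_c$ violate a triangle inequality), $\omega_{a,b}^{c}=0$ by convention. If there is exactly one $c$ with $d_c=k+\ell-m$, and likewise for $k,\ell$, one writes $\omega_{k,\ell}^{(m)}$ for the constant with $d_a=k$, $d_b=\ell$, $d_c=k+\ell-m$ ($m$ is then the order of the transvectant). An $\mathfrak{sl}_2$-triple is principal if the centralizer of its nilpotent element $E$ has dimension equal to the rank of $\mathfrak g$. Let $n\ge 2$. * For $\mathfrak{sl}_{2n-1}$ take any principal triple and the highest weight vectors $E^k$, $1\le k\le 2n-2$ (with $d=k$). * For $\mathfrak{so}_{2n-1}=\{M: M^T=-M\}$ take any principal triple and the highest weight vectors $E^k$, $k=1,3,\dots,2n-3$ (with $d=k$). * Let $\mathfrak{so}_{2n}$ be the Lie algebra of $2n\times 2n$ matrices that are skew-adjoint for the antidiagonal symmetric form. Take any triple in $\mathfrak{so}_{2n}$ whose lowering element is the principal nilpotent $$F=\sum_{i=1}^{n-1}E_{i+1,i}+E_{n+1,n-1}-E_{n+2,n}-\sum_{i=n+1}^{2n-1}E_{i+1,i},$$ with highest weight vectors $E^k$ for the summands $V_k$, $k=1,3,\dots,2n-3$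 (with $d=k$), and one extra summand $V_{n'}$, with $d=n-1$, generated by its lowest weight vector $S=E_{n,1}-E_{n+1,1}+E_{2n,n}-E_{2n,n+1}$, with any non-zero multiple of $\mathrm{ad}_E^{2n-2}(S)$ as highest weight vector. (The index $n'$ is distinct from the odd index $n-1$ when $n$ is even.) **Proposition.** In each of these three cases the vectors $G_{a,p}$ form a basis, $\mathfrak g=\bigoplus_a V_a$, and the structure constants exist and are unique. Moreover: 1. In $\mathfrak{so}_{2n}$, for all $k,\ell,m\in\{1,3,\dots,2n-3\}$, the component in $V_{n'}$ of the bracket $V_k\times V_\ell\to\mathfrak{so}_{2n}$, the component in $V_m$ of the bracket $V_k\times V_{n'}\to\mathfrak{so}_{2n}$, and the component in $V_{n'}$ of the bracket $V_{n'}\times V_{n'}\to\mathfrak{so}_{2n}$ have vanishing structure constants: $\omega_{k,\ell}^{n'}=0$, $\omega_{k,n'}^{m}=0$ and $\omega_{n',n'}^{n'}=0$ (here superscripts denote the target summand). 2. For all odd $k,\ell\in\{1,3,\dots,2n-3\}$ and every odd $m$ such that $k+\ell-m\in\{1,3,\dots,2n-3\}$, and with the constants of $\mathfrak{so}_{2n}$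 taken with respect to the summands $V_k,V_\ell,V_{k+\ell-m}$ with odd index (not $V_{n'}$), $$\omega_{k,\ell}^{(m)}(\mathfrak{so}_{2n})=\omega_{k,\ell}^{(m)}(\mathfrak{so}_{2n-1})=\omega_{k,\ell}^{(m)}(\mathfrak{sl}_{2n-1}).$$ -/

import Mathlib

open scoped TensorProduct

attribute [local instance 100] LieRing.ofAssociativeRing

/-! ### Transvectants -/

/-- Cayley's operator `Ω = ∂x ⊗ ∂y - ∂y ⊗ ∂x` on `ℂ[x,y] ⊗ ℂ[x,y]` (`x = X 0`, `y = X 1`). -/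
noncomputable def cayleyOmega :
    Module.End ℂ (MvPolynomial (Fin 2) ℂ ⊗[ℂ] MvPolynomial (Fin 2) ℂ) :=
  TensorProduct.map (MvPolynomial.pderiv (R := ℂ) (0 : Fin 2)).toLinearMap
      (MvPolynomial.pderiv (R := ℂ) (1 : Fin 2)).toLinearMap
    - TensorProduct.map (MvPolynomial.pderiv (R := ℂ) (1 : Fin 2)).toLinearMap
      (MvPolynomial.pderiv (R := ℂ) (0 : Fin 2)).toLinearMap

/-- The `m`-th transvectant: iterate `Ω` `m` times, then multiply. -/
noncomputable def transvectant (m : ℕ) (P Q : MvPolynomial (Fin 2) ℂ) : MvPolynomial (Fin 2) ℂ :=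
  LinearMap.mul' ℂ (MvPolynomial (Fin 2) ℂ) ((cayleyOmega ^ m) (P ⊗ₜ[ℂ] Q))

/-- The exponent vector of `x ^ a * y ^ b`. -/
noncomputable def xyExp (a b : ℕ) : Fin 2 →₀ ℕ := Finsupp.single 0 a + Finsupp.single 1 b

/-! ### The natural basis attached to an `sl₂`-triple and highest weight vectors -/

section NaturalBasis

variable {L : Type*} [LieRing L] [LieAlgebra ℂ L] {ι : Type*}

/-- `natG f v i j = ad_f ^ j (v i)`, the `j`-th vector below the highest weight vector `v i`. -/
noncomputable def natG (f : L) (v : ι → L) (i : ι) (j : ℕ) : L :=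
  ((LieAlgebra.ad ℂ L f) ^ j) (v i)

/-- `L` is the direct sum of irreducible `sl₂`-modules `V i` of dimension `2 * d i + 1` with highest
weight vectors `v i`; the vectors `ad_f ^ j (v i)`, `0 ≤ j ≤ 2 * d i`, form a basis of `L`. -/
structure IsNaturalBasis (h e f : L) (d : ι → ℕ) (v : ι → L) : Prop where
  lie_e : ∀ i, ⁅e, v i⁆ = 0
  lie_h : ∀ i, ⁅h, v i⁆ = (2 * (d i : ℂ)) • v i
  linearIndependent :
    LinearIndependent ℂ (fun p : (i : ι) × Fin (2 * d i + 1) => natG f v p.1 p.2)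
  span_eq_top :
    Submodule.span ℂ (Set.range fun p : (i : ι) × Fin (2 * d i + 1) => natG f v p.1 p.2) = ⊤

/-- The monomial `y ^ j * x ^ (2 * d - j) / (2 * d - j)!` attached to `ad_f ^ j (v i)`
when `d = d i` and `j ≤ 2 * d`. -/
noncomputable def natMonomial (d j : ℕ) : MvPolynomial (Fin 2) ℂ :=
  MvPolynomial.monomial (xyExp (2 * d - j) j) (((2 * d - j).factorial : ℂ)⁻¹)

/-- The translation of a binary form of degree `2 * d c` back to `V c`: the linear map with
`natMonomial (d c) j ↦ natG f v c j` for `0 ≤ j ≤ 2 * d c`. -/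
noncomputable def ofBinaryForm (f : L) (d : ι → ℕ) (v : ι → L) (c : ι)
    (P : MvPolynomial (Fin 2) ℂ) : L :=
  ∑ j ∈ Finset.range (2 * d c + 1),
    (MvPolynomial.coeff (xyExp (2 * d c - j) j) P * ((2 * d c - j).factorial : ℂ)) • natG f v c j

/-- `ω a b c` are the structure constants of the Lie bracket in the natural basis: the component
in `V c` of the bracket of two basis vectors of `V a` and `V b` is `ω a b c` times the transvectant
of order `d a + d b - d c` of the attached monomials. When `V c` does not occur in `V a ⊗ V b`
(Clebsch-Gordan) there is no such transvectant, and `ω a b c` is `0` by convention. -/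
structure IsStructureConstants [Fintype ι] (h e f : L) (d : ι → ℕ) (v : ι → L)
    (ω : ι → ι → ι → ℂ) : Prop where
  natural : IsNaturalBasis h e f d v
  eq_zero : ∀ a b c, ¬ (d c ≤ d a + d b ∧ d a ≤ d b + d c ∧ d b ≤ d a + d c) → ω a b c = 0
  lie_eq : ∀ a b, ∀ p ≤ 2 * d a, ∀ q ≤ 2 * d b,
    ⁅natG f v a p, natG f v b q⁆ =
      ∑ c, ω a b c • ofBinaryForm f d v c
        (transvectant (d a + d b - d c) (natMonomial (d a) p) (natMonomial (d b) q))

/-- An `sl₂`-triple in a simple Lie algebra of rank `r` is principal if the centralizer of its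
nilpotent element `e` has dimension `r`. -/
structure IsPrincipalSl2Triple (r : ℕ) (h e f : L) : Prop where
  triple : IsSl2Triple h e f
  finrank_centralizer : Module.finrank ℂ (LinearMap.ker (LieAlgebra.ad ℂ L e)) = r

end NaturalBasis

/-! ### Powers of `e` as highest weight vectors -/

lemma lie_pow_of_lie_eq_two {N : ℕ} {h e : Matrix (Fin N) (Fin N) ℂ} (H : h * e - e * h = 2 • e)
    (k : ℕ) : h * e ^ k - e ^ k * h = (2 * (k : ℂ)) • e ^ k := by
  induction k with
  | zero => simp
  | succ k ih =>
    have h1 : h * e ^ (k + 1) - e ^ (k + 1) * h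
        = (h * e ^ k - e ^ k * h) * e + e ^ k * (h * e - e * h) := by
      rw [pow_succ]; noncomm_ring
    rw [h1, ih, H, pow_succ, smul_mul_assoc, mul_smul_comm, ← Nat.cast_smul_eq_nsmul ℂ, ← add_smul]
    congr 1; push_cast; ring

lemma trace_pow_eq_zero {N : ℕ} {h e f : LieAlgebra.SpecialLinear.sl (Fin N) ℂ}
    (t : IsSl2Triple h e f) (k : ℕ) :
    ((e : Matrix (Fin N) (Fin N) ℂ) ^ (k + 1)) ∈ LieAlgebra.SpecialLinear.sl (Fin N) ℂ := by
  have H : (h : Matrix (Fin N) (Fin N) ℂ) * e - e * h = 2 • (e : Matrix (Fin N) (Fin N) ℂ) := by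
    have := congrArg (Subtype.val) t.lie_h_e_nsmul
    simpa [Ring.lie_def] using this
  have h2 := congrArg Matrix.trace (lie_pow_of_lie_eq_two H (k + 1))
  rw [Matrix.trace_sub, Matrix.trace_mul_comm, sub_self, Matrix.trace_smul] at h2
  have h3 : (2 * ((k + 1 : ℕ) : ℂ)) ≠ 0 := mul_ne_zero two_ne_zero (Nat.cast_ne_zero.mpr k.succ_ne_zero)
  exact LinearMap.mem_ker.mpr ((smul_eq_zero.mp h2.symm).resolve_left h3)

/-- The highest weight vectors `e, e², …, e^(N-1)` in `sl_N`; the index `i` stands for `k = i + 1`. -/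
noncomputable def slHighest {N : ℕ} {h e f : LieAlgebra.SpecialLinear.sl (Fin N) ℂ}
    (t : IsSl2Triple h e f) (i : Fin (N - 1)) : LieAlgebra.SpecialLinear.sl (Fin N) ℂ :=
  ⟨(e : Matrix (Fin N) (Fin N) ℂ) ^ ((i : ℕ) + 1), trace_pow_eq_zero t i⟩

lemma odd_pow_mem_skewAdjoint {N : ℕ} (J : Matrix (Fin N) (Fin N) ℂ)
    (x : skewAdjointMatricesLieSubalgebra J) (k : ℕ) :
    (x : Matrix (Fin N) (Fin N) ℂ) ^ (2 * k + 1) ∈ skewAdjointMatricesLieSubalgebra J := by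
  have hx : (x : Matrix (Fin N) (Fin N) ℂ).transpose * J = J * (-x) :=
    (mem_skewAdjointMatricesSubmodule (J := J) (A₁ := x.1)).mp x.2
  have key : ∀ m : ℕ, ((x : Matrix (Fin N) (Fin N) ℂ).transpose) ^ m * J = J * (-x.1) ^ m := by
    intro m
    induction m with
    | zero => simp
    | succ m ih => rw [pow_succ, mul_assoc, hx, ← mul_assoc, ih, mul_assoc, pow_succ]
  refine (mem_skewAdjointMatricesSubmodule (J := J) (A₁ := x.1 ^ (2 * k + 1))).mpr ?_
  show (x.1 ^ (2 * k + 1)).transpose * J = J * (-(x.1 ^ (2 * k + 1)))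
  rw [Matrix.transpose_pow, key, Odd.neg_pow ⟨k, rfl⟩]

/-- The odd power `x ^ (2 * k + 1)` of an element of the Lie algebra of matrices that are
skew-adjoint for `J`. -/
noncomputable def soOddPow {N : ℕ} {J : Matrix (Fin N) (Fin N) ℂ}
    (x : skewAdjointMatricesLieSubalgebra J) (k : ℕ) : skewAdjointMatricesLieSubalgebra J :=
  ⟨(x : Matrix (Fin N) (Fin N) ℂ) ^ (2 * k + 1), odd_pow_mem_skewAdjoint J x k⟩

/-! ### Type D -/

/-- The antidiagonal symmetric form on `ℂ^N`. -/
def antidiagForm (N : ℕ) : Matrix (Fin N) (Fin N) ℂ :=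
  Matrix.of fun i j => if j = Fin.rev i then 1 else 0

/-- The Lie algebra `so_{2n}`, as the matrices that are skew-adjoint for the antidiagonal form. -/
noncomputable abbrev soD (n : ℕ) : LieSubalgebra ℂ (Matrix (Fin (2 * n)) (Fin (2 * n)) ℂ) :=
  skewAdjointMatricesLieSubalgebra (antidiagForm (2 * n))

lemma mem_soD_of {n : ℕ} {A : Matrix (Fin (2 * n)) (Fin (2 * n)) ℂ}
    (hA : ∀ i j, A (Fin.rev j) i = -A (Fin.rev i) j) : A ∈ soD n := by
  refine (mem_skewAdjointMatricesSubmodule (J := antidiagForm (2 * n)) (A₁ := A)).mpr ?_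
  show A.transpose * antidiagForm (2 * n) = antidiagForm (2 * n) * (-A)
  ext i j
  have h1 : ∀ x : Fin (2 * n), (j = Fin.rev x) ↔ (x = Fin.rev j) := fun x =>
    ⟨fun h => by rw [h, Fin.rev_rev], fun h => by rw [h, Fin.rev_rev]⟩
  simp [Matrix.mul_apply, antidiagForm, h1, hA i j]

/-- The principal nilpotent matrix: in rows and columns numbered from `1` to `2n` it is
`∑_{i<n} E_{i+1,i} + E_{n+1,n-1} - E_{n+2,n} - ∑_{n<i<2n} E_{i+1,i}`
(below, rows and columns are numbered from `0`). -/
def dFMatrix (n : ℕ) : Matrix (Fin (2 * n)) (Fin (2 * n)) ℂ :=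
  Matrix.of fun i j =>
    if (i : ℕ) = j + 1 ∧ (i : ℕ) < n then 1
    else if (i : ℕ) = n ∧ (j : ℕ) + 2 = n then 1
    else if (i : ℕ) = n + 1 ∧ (j : ℕ) + 1 = n then -1
    else if (i : ℕ) = j + 1 ∧ n ≤ (j : ℕ) then -1
    else 0

/-- The matrix `E_{n,1} - E_{n+1,1} + E_{2n,n} - E_{2n,n+1}`, rows and columns numbered from `1`
(below, they are numbered from `0`). -/
def dSMatrix (n : ℕ) : Matrix (Fin (2 * n)) (Fin (2 * n)) ℂ :=
  Matrix.of fun i j =>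
    if (i : ℕ) + 1 = n ∧ (j : ℕ) = 0 then 1
    else if (i : ℕ) = n ∧ (j : ℕ) = 0 then -1
    else if (i : ℕ) + 1 = 2 * n ∧ (j : ℕ) + 1 = n then 1
    else if (i : ℕ) + 1 = 2 * n ∧ (j : ℕ) = n then -1
    else 0

lemma dFMatrix_mem (n : ℕ) : dFMatrix n ∈ soD n := by
  apply mem_soD_of
  rintro ⟨i, hi⟩ ⟨j, hj⟩
  simp only [dFMatrix, Matrix.of_apply, Fin.val_rev]
  split_ifs <;> first | (exfalso; omega) | simp

lemma dSMatrix_mem {n : ℕ} (hn : 2 ≤ n) : dSMatrix n ∈ soD n := by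
  apply mem_soD_of
  rintro ⟨i, hi⟩ ⟨j, hj⟩
  simp only [dSMatrix, Matrix.of_apply, Fin.val_rev]
  split_ifs <;> first | (exfalso; omega) | simp

/-- The principal nilpotent element `F` of `so_{2n}`. -/
noncomputable def dF (n : ℕ) : soD n := ⟨dFMatrix n, dFMatrix_mem n⟩

/-- The additional element `S` of the centralizer of `F` in `so_{2n}`. -/
noncomputable def dS {n : ℕ} (hn : 2 ≤ n) : soD n := ⟨dSMatrix n, dSMatrix_mem hn⟩

/-- The summands of `so_{2n}`: `some i` stands for `V_k` with `k = 2 * i + 1` (so `k` runs over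
`1, 3, …, 2n - 3`), and `none` for the extra summand `V_{n'}` (`n' = n - 1`). -/
abbrev DIndex (n : ℕ) : Type := Option (Fin (n - 1))

/-- The indices `k` (with `dim V_k = 2k + 1`) of the summands of `so_{2n}`. -/
def dDeg (n : ℕ) : DIndex n → ℕ
  | some i => 2 * (i : ℕ) + 1
  | none => n - 1

/-- The highest weight vectors in `so_{2n}`: the odd powers of `E`, and for the extra summand
`V_{n'}`, the `sl₂`-module generated by its lowest weight vector `S`, the vector
`z • ad_E ^ (2n - 2) (S)`. -/
noncomputable def dHighest {n : ℕ} (hn : 2 ≤ n) (E : soD n) (z : ℂ) : DIndex n → soD n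
  | some i => soOddPow E i
  | none => z • ((LieAlgebra.ad ℂ (soD n) E) ^ (2 * n - 2)) (dS hn)

/-! ### Strings of highest weight vectors -/

section Strings

open LieModule

variable {L M : Type*} [LieRing L] [LieAlgebra ℂ L] [AddCommGroup M] [Module ℂ M]
  [LieRingModule L M] [LieModule ℂ L M] {h e f : L}

/-! Structure constants exist because tensor products of irreducible sl₂-modules are multiplicity
free. Row `p = 0` of an equivariant pairing of `V_a` and `V_b` into `V_c` determines the pairing.
The first non-zero entry of that row is a highest weight vector, so its weight forces `q = d_a + d_b
- d_c` (`row_highest`, `eq_zero_of_row_eq_zero`). Hence such pairings form a space of dimension at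
most one. The transvectant is one of them, since `Ω` is sl₂-invariant, and it is non-zero under the
triangle inequalities (`exists_ofBinaryForm_transvectant_eq`). The `V_c`-component of the bracket is
therefore a unique multiple of it.

The bases come from a dimension count: strings below independent highest weight vectors are
independent (`linearIndependent_strings`). The powers of `E` needed are non-zero because a principal
`E` is a regular nilpotent matrix: otherwise sums `∑ e^i w φᵀ e^(s-i)` make its centralizer larger
than the rank.

The comparison uses natural representations. That of the principal triple is irreducible of
dimension `2n - 1` for sl and so of that size, while for `so_{2n}` it is this module plus an
invariant line. Let `P` intertwine two of them. The relation `X P = P Y` is closed under brackets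
and relates `F` to `F'` and `E^k` to `E'^k`. It thus relates the two natural bases and forces equal
constants (`eq_of_correspondence`, `eq_of_intertwiner`).

The reflection in the invariant line commutes with the triple and anticommutes with `S`. Conjugation
by it is `1` on each `V_k` and `-1` on `V_{n'}`, so constants with an odd number of indices `n'`
vanish (`exists_reflection`). This also removes the `V_{n'}`-components that would obstruct the
comparison. -/

lemma lie_e_pow_succ (t : IsSl2Triple h e f) {v : M} {μ : ℂ} (hh : ⁅h, v⁆ = μ • v)
    (he : ⁅e, v⁆ = 0) (j : ℕ) :
    ⁅e, (toEnd ℂ L M f ^ (j + 1)) v⁆ = ((j + 1) * (μ - j)) • (toEnd ℂ L M f ^ j) v := by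
  by_cases hv : v = 0
  · simp [hv]
  · exact IsSl2Triple.HasPrimitiveVectorWith.lie_e_pow_succ_toEnd_f (t := t) ⟨hv, hh, he⟩ j

lemma pow_e_pow_f (t : IsSl2Triple h e f) {v : M} {μ : ℂ} (hh : ⁅h, v⁆ = μ • v)
    (he : ⁅e, v⁆ = 0) (j : ℕ) :
    (toEnd ℂ L M e ^ j) ((toEnd ℂ L M f ^ j) v)
      = (∏ k ∈ Finset.range j, ((k + 1 : ℂ) * (μ - k))) • v := by
  induction j with
  | zero => simp
  | succ j ih =>
    rw [pow_succ (toEnd ℂ L M e), Module.End.mul_apply, toEnd_apply_apply,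
      lie_e_pow_succ t hh he, map_smul, ih, smul_smul, Finset.prod_range_succ, mul_comm]

lemma pow_e_pow_f_of_lt (t : IsSl2Triple h e f) {v : M} {μ : ℂ} (hh : ⁅h, v⁆ = μ • v)
    (he : ⁅e, v⁆ = 0) {j J : ℕ} (hj : j < J) :
    (toEnd ℂ L M e ^ J) ((toEnd ℂ L M f ^ j) v) = 0 := by
  obtain ⟨k, rfl⟩ := Nat.exists_eq_add_of_lt hj
  rw [show j + k + 1 = k + 1 + j by ring, pow_add, Module.End.mul_apply, pow_e_pow_f t hh he,
    map_smul, pow_succ, Module.End.mul_apply, toEnd_apply_apply, he, map_zero, smul_zero]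

/-- Let `J` be the greatest depth carrying a non-zero coefficient. Then `e ^ J` kills everything
shallower and returns each vector of depth `J` to a multiple of its highest weight vector; the
multiple is non-zero because `J ≤ d i`. Here `d i` is the weight itself, not half of it. -/
theorem linearIndependent_strings (t : IsSl2Triple h e f) {ι : Type*} {d : ι → ℕ} {v : ι → M}
    (hv : LinearIndependent ℂ v) (hh : ∀ i, ⁅h, v i⁆ = (d i : ℂ) • v i)
    (he : ∀ i, ⁅e, v i⁆ = 0) :
    LinearIndependent ℂ
      (fun p : (i : ι) × Fin (d i + 1) => (toEnd ℂ L M f ^ (p.2 : ℕ)) (v p.1)) := by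
  classical
  rw [linearIndependent_iff']
  intro s g hg
  by_contra! hcon
  obtain ⟨p, hp, hgp⟩ := hcon
  obtain ⟨q, hq, hmax⟩ := Finset.exists_max_image (s.filter fun p => g p ≠ 0)
    (fun p => (p.2 : ℕ)) ⟨p, by simp [hp, hgp]⟩
  rw [Finset.mem_filter] at hq
  set J : ℕ := (q.2 : ℕ) with hJ
  set α : (i : ι) × Fin (d i + 1) → ℂ :=
    fun p => ∏ k ∈ Finset.range J, ((k + 1 : ℂ) * (d p.1 - k)) with hα
  have key : ∑ p ∈ s.filter (fun p => (p.2 : ℕ) = J), (g p * α p) • v p.1 = 0 := by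
    have := congrArg (toEnd ℂ L M e ^ J) hg
    rw [map_zero, map_sum] at this
    rw [← this, Finset.sum_filter]
    refine Finset.sum_congr rfl fun p hp => ?_
    rw [map_smul]
    split_ifs with hpJ
    · rw [hpJ, pow_e_pow_f t (hh p.1) (he p.1), smul_smul]
    · rcases lt_or_gt_of_ne hpJ with hlt | hgt
      · rw [pow_e_pow_f_of_lt t (hh p.1) (he p.1) hlt, smul_zero]
      · have : g p = 0 := by
          by_contra hne
          exact absurd (hmax p (Finset.mem_filter.2 ⟨hp, hne⟩)) (not_le.2 hgt)
        rw [this, zero_smul]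
  have hv' : LinearIndependent ℂ
      (fun p : {p : (i : ι) × Fin (d i + 1) // (p.2 : ℕ) = J} => v p.1.1) := by
    refine hv.comp (fun p : {p : (i : ι) × Fin (d i + 1) // (p.2 : ℕ) = J} => p.1.1) ?_
    rintro ⟨⟨i, a⟩, ha⟩ ⟨⟨j, b⟩, hb⟩ hij
    obtain rfl : i = j := hij
    obtain rfl : a = b := Fin.ext (ha.trans hb.symm)
    rfl
  rw [linearIndependent_iff'] at hv'
  have h0 := hv' (s.subtype fun p => (p.2 : ℕ) = J) (fun p => g p.1 * α p.1)
    (by rw [← key, ← Finset.sum_subtype_eq_sum_filter]) ⟨q, rfl⟩ (by simpa using hq.1)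
  refine mul_ne_zero hq.2 (Finset.prod_ne_zero_iff.2 fun k hk => mul_ne_zero ?_ ?_) h0
  · exact Nat.cast_add_one_ne_zero k
  · have := q.2.isLt
    rw [Finset.mem_range] at hk
    rw [sub_ne_zero]
    exact_mod_cast (by omega : d q.1 ≠ k)

/-- The highest weight vector generated by a lowest weight vector. -/
lemma highest_of_lowest [Module.Finite ℂ M] (t : IsSl2Triple h e f) {v : M} {n : ℕ} (hv : v ≠ 0)
    (hh : ⁅h, v⁆ = -(n : ℂ) • v) (hf : ⁅f, v⁆ = 0) :
    (toEnd ℂ L M e ^ n) v ≠ 0 ∧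
      ⁅h, (toEnd ℂ L M e ^ n) v⁆ = (n : ℂ) • (toEnd ℂ L M e ^ n) v ∧
      ⁅e, (toEnd ℂ L M e ^ n) v⁆ = 0 := by
  -- The opposite triple `(-h, f, e)` turns a lowest weight vector into a highest one.
  have P : IsSl2Triple.HasPrimitiveVectorWith t.symm v (n : ℂ) :=
    ⟨hv, by rw [neg_lie, hh, neg_smul, neg_neg], hf⟩
  refine ⟨P.pow_toEnd_f_ne_zero_of_eq_nat rfl le_rfl, ?_, ?_⟩
  · have h1 := P.lie_h_pow_toEnd_f n
    rw [neg_lie, neg_eq_iff_eq_neg] at h1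
    rw [h1]
    module
  · rw [P.lie_f_pow_toEnd_f, P.pow_toEnd_f_eq_zero_of_eq_nat rfl]

end Strings

/-! ### Transvectants are equivariant -/

section Transvectants

open MvPolynomial

/-- The operator `y ∂x` on binary forms. -/
noncomputable def polyF : Module.End ℂ (MvPolynomial (Fin 2) ℂ) :=
  LinearMap.mulLeft ℂ (X 1) ∘ₗ (pderiv (R := ℂ) (0 : Fin 2)).toLinearMap

/-- The operator `x ∂y` on binary forms. -/
noncomputable def polyE : Module.End ℂ (MvPolynomial (Fin 2) ℂ) :=
  LinearMap.mulLeft ℂ (X 0) ∘ₗ (pderiv (R := ℂ) (1 : Fin 2)).toLinearMap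

lemma polyF_apply (P : MvPolynomial (Fin 2) ℂ) : polyF P = X 1 * pderiv 0 P := rfl

lemma polyE_apply (P : MvPolynomial (Fin 2) ℂ) : polyE P = X 0 * pderiv 1 P := rfl

/-- The diagonal action of an operator on a tensor square. -/
noncomputable def diagAction (A : Module.End ℂ (MvPolynomial (Fin 2) ℂ)) :
    Module.End ℂ (MvPolynomial (Fin 2) ℂ ⊗[ℂ] MvPolynomial (Fin 2) ℂ) :=
  TensorProduct.map A LinearMap.id + TensorProduct.map LinearMap.id A

lemma pderiv_comm (P : MvPolynomial (Fin 2) ℂ) (i j : Fin 2) :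
    pderiv i (pderiv j P) = pderiv j (pderiv i P) := by
  have h : ⁅pderiv (R := ℂ) i, pderiv (R := ℂ) j⁆ = 0 := by
    apply MvPolynomial.derivation_ext
    intro k
    rw [Derivation.commutator_apply]
    simp only [pderiv_X, Derivation.zero_apply]
    by_cases h1 : k = j <;> by_cases h2 : k = i <;> by_cases h3 : i = j <;>
      simp_all
  have := DFunLike.congr_fun h P
  rw [Derivation.commutator_apply, Derivation.zero_apply, sub_eq_zero] at this
  exact this

/-- Since `[∂y, y∂x] = ∂x` and `[∂x, y∂x] = 0`, the two terms of `Ω` contribute `∂x ⊗ ∂x` with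
opposite signs. -/
lemma commute_diagAction_polyF : Commute (diagAction polyF) cayleyOmega := by
  apply TensorProduct.ext'
  intro P Q
  simp only [Module.End.mul_apply, diagAction, cayleyOmega, LinearMap.sub_apply,
    LinearMap.add_apply, TensorProduct.map_tmul, map_sub, map_add, LinearMap.id_apply,
    Derivation.coeFn_coe, polyF_apply, Derivation.leibniz, pderiv_X, smul_eq_mul]
  simp [TensorProduct.tmul_add, TensorProduct.add_tmul, pderiv_comm _ 1 0]
  abel

lemma commute_diagAction_polyE : Commute (diagAction polyE) cayleyOmega := by
  apply TensorProduct.ext'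
  intro P Q
  simp only [Module.End.mul_apply, diagAction, cayleyOmega, LinearMap.sub_apply,
    LinearMap.add_apply, TensorProduct.map_tmul, map_sub, map_add, LinearMap.id_apply,
    Derivation.coeFn_coe, polyE_apply, Derivation.leibniz, pderiv_X, smul_eq_mul]
  simp [TensorProduct.tmul_add, TensorProduct.add_tmul, pderiv_comm _ 1 0]
  abel

/-- A derivation passes through multiplication as the diagonal action, which commutes with every
power of `Ω`. -/
lemma transvectant_equivariant {A : Module.End ℂ (MvPolynomial (Fin 2) ℂ)}
    (hA : Commute (diagAction A) cayleyOmega)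
    (hd : ∀ P Q, A (P * Q) = A P * Q + P * A Q) (m : ℕ) (P Q : MvPolynomial (Fin 2) ℂ) :
    A (transvectant m P Q) = transvectant m (A P) Q + transvectant m P (A Q) := by
  have hmul : ∀ w : MvPolynomial (Fin 2) ℂ ⊗[ℂ] MvPolynomial (Fin 2) ℂ,
      A (LinearMap.mul' ℂ _ w) = LinearMap.mul' ℂ _ (diagAction A w) := by
    intro w
    induction w with
    | zero => simp
    | tmul P Q => simp [diagAction, hd]
    | add x y hx hy => simp only [map_add, hx, hy]
  have hc := LinearMap.congr_fun (hA.pow_right m).eq (P ⊗ₜ[ℂ] Q)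
  simp only [Module.End.mul_apply] at hc
  rw [transvectant, hmul, hc]
  simp [diagAction, transvectant]

lemma polyF_transvectant (m : ℕ) (P Q : MvPolynomial (Fin 2) ℂ) :
    polyF (transvectant m P Q) = transvectant m (polyF P) Q + transvectant m P (polyF Q) :=
  transvectant_equivariant commute_diagAction_polyF
    (fun P Q => by simp only [polyF_apply, Derivation.leibniz, smul_eq_mul]; ring) m P Q

lemma polyE_transvectant (m : ℕ) (P Q : MvPolynomial (Fin 2) ℂ) :
    polyE (transvectant m P Q) = transvectant m (polyE P) Q + transvectant m P (polyE Q) :=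
  transvectant_equivariant commute_diagAction_polyE
    (fun P Q => by simp only [polyE_apply, Derivation.leibniz, smul_eq_mul]; ring) m P Q

lemma transvectant_smul_left (m : ℕ) (c : ℂ) (P Q : MvPolynomial (Fin 2) ℂ) :
    transvectant m (c • P) Q = c • transvectant m P Q := by
  simp only [transvectant, ← TensorProduct.smul_tmul', map_smul]

lemma transvectant_smul_right (m : ℕ) (c : ℂ) (P Q : MvPolynomial (Fin 2) ℂ) :
    transvectant m P (c • Q) = c • transvectant m P Q := by
  simp [transvectant]

end Transvectants

/-! ### The sl₂-action on monomials, and a non-vanishing transvectant -/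

section Monomials

open MvPolynomial

lemma xyExp_injective {a b a' b' : ℕ} (h : xyExp a b = xyExp a' b') : a = a' ∧ b = b' := by
  have h0 := DFunLike.congr_fun h 0
  have h1 := DFunLike.congr_fun h 1
  simp [xyExp] at h0 h1
  exact ⟨h0, h1⟩

lemma monomial_xyExp (a b : ℕ) (c : ℂ) :
    monomial (xyExp a b) c = C c * X 0 ^ a * X 1 ^ b := by
  rw [xyExp, MvPolynomial.monomial_eq, Finsupp.prod_add_index' (by simp) (by simp [pow_add])]
  simp [mul_assoc]

lemma natMonomial_eq (d j : ℕ) :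
    natMonomial d j = C (((2 * d - j).factorial : ℂ)⁻¹) * X 0 ^ (2 * d - j) * X 1 ^ j :=
  monomial_xyExp _ _ _

/-- The factor `1 / (2d - j)!` is what makes `y∂x` shift the index with no scalar, exactly as `ad_f`
does on `natG`. -/
lemma polyF_natMonomial {d j : ℕ} (hj : j < 2 * d) :
    polyF (natMonomial d j) = natMonomial d (j + 1) := by
  obtain ⟨k, hk⟩ := Nat.exists_eq_add_of_lt hj
  rw [natMonomial_eq, natMonomial_eq, polyF_apply, show 2 * d - j = k + 1 by omega,
    show 2 * d - (j + 1) = k by omega]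
  have : (((k + 1).factorial : ℂ)⁻¹) * (k + 1) = (k.factorial : ℂ)⁻¹ := by
    rw [Nat.factorial_succ]; push_cast
    have : (k : ℂ) + 1 ≠ 0 := Nat.cast_add_one_ne_zero k
    have := Nat.cast_ne_zero (R := ℂ).2 (Nat.factorial_ne_zero k)
    field_simp
  rw [← this, C_mul]
  simp [Derivation.leibniz, Derivation.leibniz_pow, pderiv_X]
  ring

lemma polyF_natMonomial_top (d : ℕ) : polyF (natMonomial d (2 * d)) = 0 := by
  rw [natMonomial_eq, polyF_apply]
  simp [Derivation.leibniz_pow, pderiv_X]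

lemma polyE_natMonomial {d j : ℕ} (hj : j < 2 * d) :
    polyE (natMonomial d (j + 1)) = ((j + 1 : ℂ) * (2 * d - j)) • natMonomial d j := by
  obtain ⟨k, hk⟩ := Nat.exists_eq_add_of_lt hj
  rw [natMonomial_eq, natMonomial_eq, polyE_apply, show 2 * d - j = k + 1 by omega,
    show 2 * d - (j + 1) = k by omega]
  have : (((k + 1).factorial : ℂ)⁻¹) * (k + 1) = (k.factorial : ℂ)⁻¹ := by
    rw [Nat.factorial_succ]; push_cast
    have : (k : ℂ) + 1 ≠ 0 := Nat.cast_add_one_ne_zero k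
    have := Nat.cast_ne_zero (R := ℂ).2 (Nat.factorial_ne_zero k)
    field_simp
  have hk' : (2 * d - j : ℂ) = k + 1 := by
    have : (2 * d : ℂ) = j + k + 1 := by exact_mod_cast hk
    rw [this]; ring
  rw [hk', ← this, C_mul, MvPolynomial.smul_eq_C_mul, C_mul]
  simp [Derivation.leibniz, Derivation.leibniz_pow, pderiv_X]
  ring

lemma polyE_natMonomial_zero (d : ℕ) : polyE (natMonomial d 0) = 0 := by
  rw [natMonomial_eq, polyE_apply]
  simp [Derivation.leibniz, Derivation.leibniz_pow, pderiv_X]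

/-- The monomials attached to a string, extended by zero. -/
noncomputable def stringMonomial (d j : ℕ) : MvPolynomial (Fin 2) ℂ :=
  if j ≤ 2 * d then natMonomial d j else 0

/-- The cutoff is needed for this to hold at every `j`: beyond `2 * d`, truncated subtraction makes
`natMonomial d j` equal to `y ^ j`, not zero. -/
lemma polyF_stringMonomial (d j : ℕ) : polyF (stringMonomial d j) = stringMonomial d (j + 1) := by
  unfold stringMonomial
  rcases lt_trichotomy j (2 * d) with h | h | h
  · rw [if_pos h.le, if_pos (by omega), polyF_natMonomial h]
  · rw [if_pos h.le, if_neg (by omega), h, polyF_natMonomial_top]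
  · rw [if_neg (by omega), if_neg (by omega), map_zero]

lemma polyE_stringMonomial_succ (d j : ℕ) :
    polyE (stringMonomial d (j + 1)) = ((j + 1 : ℂ) * (2 * d - j)) • stringMonomial d j := by
  unfold stringMonomial
  rcases lt_trichotomy j (2 * d) with h | h | h
  · rw [if_pos h.le, if_pos (by omega), polyE_natMonomial h]
  · rw [if_pos h.le, if_neg (by omega), map_zero, h]
    simp
  · rw [if_neg (by omega), if_neg (by omega), map_zero, smul_zero]

lemma polyE_stringMonomial_zero (d : ℕ) : polyE (stringMonomial d 0) = 0 := by
  rw [stringMonomial, if_pos (Nat.zero_le _), polyE_natMonomial_zero]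

lemma polyE_stringMonomial (d j : ℕ) :
    polyE (stringMonomial d j) = ((j : ℂ) * (2 * d - j + 1)) • stringMonomial d (j - 1) := by
  cases j with
  | zero => simp [polyE_stringMonomial_zero]
  | succ j =>
    rw [polyE_stringMonomial_succ]
    push_cast
    rw [show (2 * (d : ℂ) - (j + 1) + 1) = 2 * d - j by ring]

/-- Cayley's operator on the tensor product of a power of `x` with a monomial. -/
lemma cayleyOmega_pow_apply (a b q m : ℕ) :
    (cayleyOmega ^ m) ((X 0 ^ (a + m) : MvPolynomial (Fin 2) ℂ) ⊗ₜ[ℂ] (X 0 ^ b * X 1 ^ (q + m)))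
      = (((a + m).descFactorial m * (q + m).descFactorial m : ℕ) : ℂ) •
        ((X 0 ^ a : MvPolynomial (Fin 2) ℂ) ⊗ₜ[ℂ] (X 0 ^ b * X 1 ^ q)) := by
  induction m with
  | zero => simp
  | succ m ih =>
    have h1 : cayleyOmega ((X 0 ^ (a + m + 1) : MvPolynomial (Fin 2) ℂ) ⊗ₜ[ℂ]
        (X 0 ^ b * X 1 ^ (q + m + 1)))
        = (((a + m + 1) * (q + m + 1) : ℕ) : ℂ) •
          ((X 0 ^ (a + m) : MvPolynomial (Fin 2) ℂ) ⊗ₜ[ℂ] (X 0 ^ b * X 1 ^ (q + m))) := by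
      have e1 : pderiv (R := ℂ) 0 ((X 0 : MvPolynomial (Fin 2) ℂ) ^ (a + m + 1))
          = ((a + m + 1 : ℕ) : ℂ) • X 0 ^ (a + m) := by
        simp [Derivation.leibniz_pow, pderiv_X, MvPolynomial.smul_eq_C_mul]
      -- The left factor contains no `y`, so only the term `∂x ⊗ ∂y` of `Ω` contributes.
      have e2 : pderiv (R := ℂ) 1 ((X 0 : MvPolynomial (Fin 2) ℂ) ^ (a + m + 1)) = 0 := by
        simp [Derivation.leibniz_pow, pderiv_X]
      have e3 : pderiv (R := ℂ) 1 ((X 0 ^ b * X 1 ^ (q + m + 1) : MvPolynomial (Fin 2) ℂ))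
          = ((q + m + 1 : ℕ) : ℂ) • (X 0 ^ b * X 1 ^ (q + m)) := by
        simp [Derivation.leibniz, Derivation.leibniz_pow, pderiv_X, MvPolynomial.smul_eq_C_mul]
        ring
      rw [cayleyOmega, LinearMap.sub_apply, TensorProduct.map_tmul, TensorProduct.map_tmul]
      simp only [Derivation.coeFn_coe]
      rw [e1, e2, e3, TensorProduct.zero_tmul, sub_zero, TensorProduct.smul_tmul_smul]
      push_cast
      rfl
    rw [pow_succ, Module.End.mul_apply, ← add_assoc, ← add_assoc, h1, map_smul, ih, smul_smul]
    congr 1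
    rw [Nat.succ_descFactorial_succ, Nat.succ_descFactorial_succ]
    push_cast
    ring

/-- On this pair `Ω^m` acts as `∂x^m ⊗ ∂y^m`, which uses up every `y` and leaves a pure power of
`x`. The bounds on `m` are two of the triangle inequalities. -/
lemma transvectant_natMonomial (a b c m : ℕ) (hm : m + c = a + b) (ha : m ≤ 2 * a)
    (hb : m ≤ 2 * b) :
    ∃ τ : ℂ, τ ≠ 0 ∧
      transvectant m (natMonomial a 0) (natMonomial b m) = τ • monomial (xyExp (2 * c) 0) 1 := by
  obtain ⟨k, hk⟩ := Nat.exists_eq_add_of_le ha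
  refine ⟨((2 * a).factorial : ℂ)⁻¹ * ((2 * b - m).factorial : ℂ)⁻¹ *
    (((2 * a).descFactorial m * m.descFactorial m : ℕ) : ℂ), ?_, ?_⟩
  · have h1 : (2 * a).descFactorial m ≠ 0 := by
      rw [Ne, Nat.descFactorial_eq_zero_iff_lt]; omega
    have h2 : m.descFactorial m ≠ 0 := by
      rw [Ne, Nat.descFactorial_eq_zero_iff_lt]; omega
    exact mul_ne_zero (mul_ne_zero (inv_ne_zero (Nat.cast_ne_zero.2 (Nat.factorial_ne_zero _)))
      (inv_ne_zero (Nat.cast_ne_zero.2 (Nat.factorial_ne_zero _))))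
      (Nat.cast_ne_zero.2 (mul_ne_zero h1 h2))
  · have h := cayleyOmega_pow_apply k (2 * b - m) 0 m
    rw [natMonomial_eq, natMonomial_eq, mul_assoc, mul_assoc, ← MvPolynomial.smul_eq_C_mul,
      ← MvPolynomial.smul_eq_C_mul, transvectant_smul_left, transvectant_smul_right, transvectant,
      pow_zero, mul_one, Nat.sub_zero, hk, add_comm m k]
    rw [zero_add] at h
    rw [h, map_smul, smul_smul, smul_smul, monomial_xyExp]
    congr 1
    rw [LinearMap.mul'_apply, ← mul_assoc, ← pow_add, show 2 * c = k + (2 * b - m) by omega]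
    simp

lemma coeff_X_mul_pderiv (i j : Fin 2) (P : MvPolynomial (Fin 2) ℂ) (s : Fin 2 →₀ ℕ) :
    coeff (s + Finsupp.single i 1) (X i * pderiv j P)
      = (s j + 1) * coeff (s + Finsupp.single j 1) P := by
  rw [add_comm s, coeff_X_mul]
  induction P using MvPolynomial.induction_on' with
  | monomial u a =>
    rw [pderiv_monomial, coeff_monomial, coeff_monomial]
    by_cases h : u = s + Finsupp.single j 1
    · subst h
      simp [mul_comm]
    · rw [if_neg h, mul_zero]
      by_cases h2 : u j = 0
      · simp [h2]
      · rw [if_neg]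
        rintro rfl
        apply h
        rw [tsub_add_cancel_of_le]
        rw [Finsupp.single_le_iff]
        omega
  | add p q hp hq => rw [map_add, coeff_add, hp, hq, coeff_add, mul_add]

lemma coeff_polyF_succ (a j : ℕ) (P : MvPolynomial (Fin 2) ℂ) :
    coeff (xyExp a (j + 1)) (polyF P) = (a + 1) * coeff (xyExp (a + 1) j) P := by
  have := coeff_X_mul_pderiv 1 0 P (xyExp a j)
  rw [polyF_apply]
  convert! this using 2
  · simp [xyExp, add_assoc]
  · simp [xyExp]
  · simp only [xyExp, Finsupp.single_add, add_right_comm]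

lemma coeff_polyF_zero (a : ℕ) (P : MvPolynomial (Fin 2) ℂ) :
    coeff (xyExp a 0) (polyF P) = 0 := by
  rw [polyF_apply, coeff_X_mul', if_neg]
  simp [xyExp]

lemma coeff_polyE_succ (a j : ℕ) (P : MvPolynomial (Fin 2) ℂ) :
    coeff (xyExp (a + 1) j) (polyE P) = (j + 1) * coeff (xyExp a (j + 1)) P := by
  have := coeff_X_mul_pderiv 0 1 P (xyExp a j)
  rw [polyE_apply]
  convert! this using 2
  · simp only [xyExp, Finsupp.single_add, add_right_comm]
  · simp [xyExp]
  · simp [xyExp, add_assoc]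

lemma coeff_polyE_zero (j : ℕ) (P : MvPolynomial (Fin 2) ℂ) :
    coeff (xyExp 0 j) (polyE P) = 0 := by
  rw [polyE_apply, coeff_X_mul', if_neg]
  simp [xyExp]

end Monomials

/-! ### Existence and uniqueness of the structure constants -/

section StructureConstants

variable {L : Type*} [LieRing L] [LieAlgebra ℂ L] {ι : Type*} {h e f : L} {d : ι → ℕ} {v : ι → L}

lemma lie_f_natG (f : L) (v : ι → L) (i : ι) (j : ℕ) : ⁅f, natG f v i j⁆ = natG f v i (j + 1) := by
  rw [natG, natG, pow_succ', Module.End.mul_apply, LieAlgebra.ad_apply]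

@[simp] lemma natG_zero (f : L) (v : ι → L) (i : ι) : natG f v i 0 = v i := by simp [natG]

namespace IsNaturalBasis

/-- The truncated index `j - 1` is harmless at `j = 0`, where the coefficient vanishes. -/
lemma lie_e_natG (hN : IsNaturalBasis h e f d v) (t : IsSl2Triple h e f) (i : ι) (j : ℕ) :
    ⁅e, natG f v i j⁆ = ((j : ℂ) * (2 * d i - j + 1)) • natG f v i (j - 1) := by
  cases j with
  | zero => simp [hN.lie_e]
  | succ j =>
    have := lie_e_pow_succ t (hN.lie_h i) (hN.lie_e i) j
    rw [natG, natG, Nat.add_sub_cancel]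
    refine this.trans ?_
    congr 1
    push_cast
    ring

/-- The basis of strings. -/
noncomputable def basis (hN : IsNaturalBasis h e f d v) :
    Module.Basis ((i : ι) × Fin (2 * d i + 1)) ℂ L :=
  Module.Basis.mk hN.linearIndependent hN.span_eq_top.ge

lemma basis_apply (hN : IsNaturalBasis h e f d v) (p : (i : ι) × Fin (2 * d i + 1)) :
    hN.basis p = natG f v p.1 p.2 := by
  rw [basis, Module.Basis.mk_apply]

lemma ne_zero (hN : IsNaturalBasis h e f d v) (i : ι) : v i ≠ 0 := by
  have := hN.linearIndependent.ne_zero ⟨i, 0⟩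
  simpa using this

lemma natG_eq_zero [Finite ι] (hN : IsNaturalBasis h e f d v) (t : IsSl2Triple h e f) (i : ι)
    {j : ℕ} (hj : 2 * d i < j) : natG f v i j = 0 := by
  have : Module.Finite ℂ L := Module.Finite.of_basis hN.basis
  have h0 := IsSl2Triple.HasPrimitiveVectorWith.pow_toEnd_f_eq_zero_of_eq_nat (t := t)
    (n := 2 * d i) ⟨hN.ne_zero i, hN.lie_h i, hN.lie_e i⟩ (by push_cast; rfl)
  obtain ⟨k, rfl⟩ := Nat.exists_eq_add_of_lt hj
  rw [natG, show 2 * d i + k + 1 = k + (2 * d i + 1) by ring, pow_add, Module.End.mul_apply]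
  exact (congrArg _ h0).trans (map_zero _)

open Classical in
/-- The projection onto a summand. -/
noncomputable def proj (hN : IsNaturalBasis h e f d v) (c : ι) : L →ₗ[ℂ] L :=
  hN.basis.constr ℂ (fun p => if p.1 = c then natG f v p.1 p.2 else 0)

open Classical in
lemma proj_natG [Finite ι] (hN : IsNaturalBasis h e f d v) (t : IsSl2Triple h e f) (c i : ι)
    (j : ℕ) : hN.proj c (natG f v i j) = if i = c then natG f v i j else 0 := by
  by_cases hj : j ≤ 2 * d i
  · have := hN.basis.constr_basis ℂ (fun p => if p.1 = c then natG f v p.1 p.2 else 0)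
      ⟨i, ⟨j, by omega⟩⟩
    rw [basis_apply] at this
    exact this
  · rw [hN.natG_eq_zero t i (by omega), map_zero, ite_self]

lemma proj_natG_self [Finite ι] (hN : IsNaturalBasis h e f d v) (t : IsSl2Triple h e f) (c : ι)
    (j : ℕ) : hN.proj c (natG f v c j) = natG f v c j := by
  rw [hN.proj_natG t, if_pos rfl]

lemma induction_natG (hN : IsNaturalBasis h e f d v) {A B : L →ₗ[ℂ] L}
    (H : ∀ i j, A (natG f v i j) = B (natG f v i j)) (x : L) : A x = B x := by
  refine LinearMap.congr_fun (hN.basis.ext fun p => ?_) x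
  rw [basis_apply, H]

lemma proj_lie_f [Finite ι] (hN : IsNaturalBasis h e f d v) (t : IsSl2Triple h e f) (c : ι)
    (x : L) : hN.proj c ⁅f, x⁆ = ⁅f, hN.proj c x⁆ := by
  refine hN.induction_natG (A := hN.proj c ∘ₗ LieAlgebra.ad ℂ L f)
    (B := LieAlgebra.ad ℂ L f ∘ₗ hN.proj c) (fun i j => ?_) x
  simp only [LinearMap.comp_apply, LieAlgebra.ad_apply, lie_f_natG, hN.proj_natG t]
  split_ifs <;> simp [lie_f_natG]

lemma proj_lie_e [Finite ι] (hN : IsNaturalBasis h e f d v) (t : IsSl2Triple h e f) (c : ι)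
    (x : L) : hN.proj c ⁅e, x⁆ = ⁅e, hN.proj c x⁆ := by
  refine hN.induction_natG (A := hN.proj c ∘ₗ LieAlgebra.ad ℂ L e)
    (B := LieAlgebra.ad ℂ L e ∘ₗ hN.proj c) (fun i j => ?_) x
  simp only [LinearMap.comp_apply, LieAlgebra.ad_apply, hN.lie_e_natG t, hN.proj_natG t, map_smul]
  split_ifs <;> simp [hN.lie_e_natG t]

lemma proj_proj [Finite ι] (hN : IsNaturalBasis h e f d v) (t : IsSl2Triple h e f) (c : ι)
    (x : L) : hN.proj c (hN.proj c x) = hN.proj c x := by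
  refine hN.induction_natG (A := hN.proj c ∘ₗ hN.proj c) (fun i j => ?_) x
  simp only [LinearMap.comp_apply, hN.proj_natG t]
  split_ifs with hi
  · rw [hN.proj_natG t, if_pos hi]
  · simp

lemma sum_proj [Fintype ι] (hN : IsNaturalBasis h e f d v) (t : IsSl2Triple h e f) (x : L) :
    ∑ c, hN.proj c x = x := by
  rw [← LinearMap.sum_apply]
  refine hN.induction_natG (B := LinearMap.id) (fun i j => ?_) x
  rw [LinearMap.sum_apply, Finset.sum_eq_single i, hN.proj_natG_self t, LinearMap.id_apply]
  · intro c _ hc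
    rw [hN.proj_natG t, if_neg hc.symm]
  · simp

lemma exists_proj_eq_sum [Fintype ι] (hN : IsNaturalBasis h e f d v) (c : ι) (x : L) :
    ∃ κ : ℕ → ℂ, hN.proj c x = ∑ j ∈ Finset.range (2 * d c + 1), κ j • natG f v c j := by
  classical
  refine ⟨fun j => if hj : j < 2 * d c + 1 then hN.basis.equivFun x ⟨c, ⟨j, hj⟩⟩ else 0, ?_⟩
  rw [proj, Module.Basis.constr_apply_fintype, Fintype.sum_sigma, Finset.sum_range,
    Finset.sum_eq_single c]
  · exact Finset.sum_congr rfl fun j _ => by simp [j.isLt]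
  · intro i _ hi
    simp [hi]
  · simp

/-- A vector of a summand that is annihilated by `e` is a highest weight vector. -/
lemma eq_smul_of_lie_e_eq_zero [Fintype ι] (hN : IsNaturalBasis h e f d v)
    (t : IsSl2Triple h e f) {c : ι} {x : L} (hx : hN.proj c x = x) (he : ⁅e, x⁆ = 0) :
    ∃ κ : ℂ, x = κ • v c := by
  obtain ⟨κ, hκ⟩ := hN.exists_proj_eq_sum c x
  rw [hx, Finset.sum_range_succ'] at hκ
  refine ⟨κ 0, ?_⟩
  rw [natG_zero] at hκ
  -- Applying `e` moves depth `j + 1` to a non-zero multiple of depth `j`, so the images of the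
  -- deeper terms stay independent and their coefficients must vanish.
  have hz : ∑ j : Fin (2 * d c), (κ (j + 1) * (((j : ℕ) + 1 : ℂ) * (2 * d c - (j : ℕ)))) •
      natG f v c j = 0 := by
    rw [← he, hκ, lie_add, lie_smul, hN.lie_e, smul_zero, add_zero, lie_sum, ← Finset.sum_range
      (fun j => (κ (j + 1) * (((j : ℕ) + 1 : ℂ) * (2 * d c - (j : ℕ)))) • natG f v c j)]
    refine Finset.sum_congr rfl fun j _ => ?_
    rw [lie_smul, hN.lie_e_natG t, smul_smul, Nat.add_sub_cancel]
    congr 2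
    push_cast
    ring
  have hli : LinearIndependent ℂ (fun j : Fin (2 * d c) => natG f v c j) :=
    hN.linearIndependent.comp
      (fun j : Fin (2 * d c) => (⟨c, j.castSucc⟩ : (i : ι) × Fin (2 * d i + 1)))
      (fun a b hab => by simpa using hab)
  have hk := Fintype.linearIndependent_iff.1 hli _ hz
  rw [hκ]
  refine (add_eq_right.2 (Finset.sum_eq_zero fun j hj => ?_))
  have hj' := Finset.mem_range.1 hj
  have := hk ⟨j, hj'⟩
  have h2 : ((j : ℂ) + 1) * (2 * d c - j) ≠ 0 := by
    refine mul_ne_zero (Nat.cast_add_one_ne_zero j) (sub_ne_zero.2 ?_)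
    exact_mod_cast hj'.ne'
  rw [(mul_eq_zero.1 this).resolve_right h2, zero_smul]

end IsNaturalBasis

/-- An equivariant family of vectors indexed by the product of two strings. -/
structure IsEquivariantPairing (e f : L) (a b : ℕ) (D : ℕ → ℕ → L) : Prop where
  lie_f : ∀ p q, ⁅f, D p q⁆ = D (p + 1) q + D p (q + 1)
  lie_e : ∀ p q, ⁅e, D p q⁆ = ((p : ℂ) * (2 * a - p + 1)) • D (p - 1) q +
    ((q : ℂ) * (2 * b - q + 1)) • D p (q - 1)
  eq_zero_left : ∀ p q, 2 * a < p → D p q = 0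
  eq_zero_right : ∀ p q, 2 * b < q → D p q = 0

namespace IsEquivariantPairing

variable {a b : ℕ} {D : ℕ → ℕ → L}

lemma swap (hD : IsEquivariantPairing e f a b D) :
    IsEquivariantPairing e f b a (fun p q => D q p) where
  lie_f p q := by rw [hD.lie_f, add_comm]
  lie_e p q := by rw [hD.lie_e, add_comm]
  eq_zero_left p q h := hD.eq_zero_right q p h
  eq_zero_right p q h := hD.eq_zero_left q p h

/-- The weights need no separate axiom, because `h = [e, f]`. -/
lemma lie_h (hD : IsEquivariantPairing e f a b D) (t : IsSl2Triple h e f) (q : ℕ) :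
    ⁅h, D 0 q⁆ = (2 * a + 2 * b - 2 * q : ℂ) • D 0 q := by
  rw [← t.lie_e_f, lie_lie, hD.lie_f, lie_add, hD.lie_e, hD.lie_e, hD.lie_e, lie_add, lie_smul,
    lie_smul]
  simp only [hD.lie_f]
  cases q with
  | zero =>
    simp only [zero_add, Nat.cast_one, Nat.cast_zero, Nat.sub_self, zero_mul, zero_smul, add_zero,
      sub_zero]
    module
  | succ q =>
    simp only [zero_add, Nat.cast_one, Nat.cast_zero, Nat.sub_self, zero_mul, zero_smul, sub_zero,
      Nat.add_sub_cancel, Nat.cast_add]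
    module

/-- The relation for `f` expresses row `p + 1` through row `p`. -/
lemma eq_zero_of_row (hD : IsEquivariantPairing e f a b D) (h0 : ∀ q, D 0 q = 0) (p q : ℕ) :
    D p q = 0 := by
  induction p generalizing q with
  | zero => exact h0 q
  | succ p ih =>
    have := hD.lie_f p q
    rw [ih, ih, lie_zero, add_zero] at this
    exact this.symm

variable {d : ι → ℕ} {v : ι → L} [Fintype ι]

/-- In row `0` the operator `e` only lowers `q`, the other term having coefficient `0`. An entry
preceded by zeros is thus killed by `e`, and comparing weights locates it. -/
lemma row_highest (hD : IsEquivariantPairing e f a b D) (hN : IsNaturalBasis h e f d v)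
    (t : IsSl2Triple h e f) {c : ι} (hc : ∀ p q, hN.proj c (D p q) = D p q) {q : ℕ}
    (hq : ∀ q' < q, D 0 q' = 0) :
    ∃ κ : ℂ, D 0 q = κ • v c ∧ (D 0 q ≠ 0 → d c + q = a + b) := by
  have he : ⁅e, D 0 q⁆ = 0 := by
    rw [hD.lie_e]
    cases q with
    | zero => simp
    | succ q => simp [hq q (Nat.lt_succ_self q)]
  obtain ⟨κ, hκ⟩ := hN.eq_smul_of_lie_e_eq_zero t (hc 0 q) he
  refine ⟨κ, hκ, fun hne => ?_⟩
  have h1 := hD.lie_h t q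
  have h2 : ⁅h, D 0 q⁆ = (2 * (d c : ℂ)) • D 0 q := by
    rw [hκ, lie_smul, hN.lie_h, smul_comm]
  rw [h2] at h1
  have h3 : 2 * (d c : ℂ) = 2 * a + 2 * b - 2 * q := smul_left_injective ℂ hne h1
  have h4 : (d c : ℂ) + q = a + b := by
    linear_combination h3 / 2
  exact_mod_cast h4

lemma row_eq_zero_of_lt (hD : IsEquivariantPairing e f a b D) (hN : IsNaturalBasis h e f d v)
    (t : IsSl2Triple h e f) {c : ι} (hc : ∀ p q, hN.proj c (D p q) = D p q) {q : ℕ}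
    (hq : d c + q < a + b) : D 0 q = 0 := by
  induction q using Nat.strong_induction_on with
  | _ q ih =>
    obtain ⟨κ, -, h2⟩ := hD.row_highest hN t hc (fun q' hq' => ih q' hq' (by omega))
    by_contra hne
    have := h2 hne
    omega

/-- Multiplicity one: a pairing into `V_c` is determined by the single entry `D 0 m` with `m = a + b
- d c`. When `d c > a + b` there is no such `m`, and the hypothesis `hm` is vacuous. -/
lemma eq_zero_of_row_eq_zero (hD : IsEquivariantPairing e f a b D)
    (hN : IsNaturalBasis h e f d v) (t : IsSl2Triple h e f) {c : ι}
    (hc : ∀ p q, hN.proj c (D p q) = D p q) (hm : ∀ m, d c + m = a + b → D 0 m = 0) (p q : ℕ) :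
    D p q = 0 := by
  refine hD.eq_zero_of_row (fun q => ?_) p q
  induction q using Nat.strong_induction_on with
  | _ q ih =>
    obtain ⟨κ, -, h2⟩ := hD.row_highest hN t hc ih
    by_contra hne
    exact hne (hm q (h2 hne))

/-- When a triangle inequality fails, the decisive entry is missing or lies beyond the end of a
string. The case `b > a + d c` is seen after swapping the two factors. -/
lemma eq_zero_of_not_triangle (hD : IsEquivariantPairing e f a b D)
    (hN : IsNaturalBasis h e f d v) (t : IsSl2Triple h e f) {c : ι}
    (hc : ∀ p q, hN.proj c (D p q) = D p q)
    (hn : ¬ (d c ≤ a + b ∧ a ≤ b + d c ∧ b ≤ a + d c)) (p q : ℕ) : D p q = 0 := by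
  by_cases h1 : d c ≤ a + b ∧ a ≤ b + d c
  · exact hD.swap.eq_zero_of_row_eq_zero hN t (fun p q => hc q p)
      (fun m hm => hD.eq_zero_left _ _ (by omega)) q p
  · exact hD.eq_zero_of_row_eq_zero hN t hc (fun m hm => hD.eq_zero_right _ _ (by omega)) p q

end IsEquivariantPairing

end StructureConstants

/-! ### Transvectants as equivariant pairings, and the structure constants -/

section BinaryForms

variable {L : Type*} [LieRing L] [LieAlgebra ℂ L] {ι : Type*} {h e f : L} {d : ι → ℕ} {v : ι → L}

lemma ofBinaryForm_add (f : L) (d : ι → ℕ) (v : ι → L) (c : ι) (P Q : MvPolynomial (Fin 2) ℂ) :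
    ofBinaryForm f d v c (P + Q) = ofBinaryForm f d v c P + ofBinaryForm f d v c Q := by
  simp only [ofBinaryForm, MvPolynomial.coeff_add, add_mul, add_smul, Finset.sum_add_distrib]

lemma ofBinaryForm_smul (f : L) (d : ι → ℕ) (v : ι → L) (c : ι) (r : ℂ)
    (P : MvPolynomial (Fin 2) ℂ) :
    ofBinaryForm f d v c (r • P) = r • ofBinaryForm f d v c P := by
  simp only [ofBinaryForm, MvPolynomial.coeff_smul, smul_eq_mul, mul_assoc, mul_smul,
    Finset.smul_sum]

lemma ofBinaryForm_zero (f : L) (d : ι → ℕ) (v : ι → L) (c : ι) :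
    ofBinaryForm f d v c 0 = 0 := by
  simp [ofBinaryForm]

lemma ofBinaryForm_highest (f : L) (d : ι → ℕ) (v : ι → L) (c : ι) :
    ofBinaryForm f d v c (MvPolynomial.monomial (xyExp (2 * d c) 0) 1)
      = ((2 * d c).factorial : ℂ) • v c := by
  rw [ofBinaryForm, Finset.sum_eq_single 0]
  · simp
  · intro j _ hj
    rw [MvPolynomial.coeff_monomial, if_neg, zero_mul, zero_smul]
    intro hx
    exact hj (xyExp_injective hx).2.symm
  · simp

/-- The transvectant of a highest weight vector with the suitable vector of a second string is a
non-zero highest weight vector. -/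
lemma exists_ofBinaryForm_transvectant_eq (f : L) (d : ι → ℕ) (v : ι → L) {a b : ℕ} {c : ι}
    (hT : d c ≤ a + b ∧ a ≤ b + d c ∧ b ≤ a + d c) :
    ∃ τ : ℂ, τ ≠ 0 ∧ ofBinaryForm f d v c
      (transvectant (a + b - d c) (natMonomial a 0) (natMonomial b (a + b - d c))) = τ • v c := by
  obtain ⟨τ, hτ, h⟩ := transvectant_natMonomial a b (d c) (a + b - d c) (by omega) (by omega)
    (by omega)
  refine ⟨τ * (2 * d c).factorial,
    mul_ne_zero hτ (Nat.cast_ne_zero.2 (Nat.factorial_ne_zero _)), ?_⟩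
  rw [h, ofBinaryForm_smul, ofBinaryForm_highest, smul_smul]

namespace IsNaturalBasis

/-- No homogeneity of `P` is needed: only coefficients of degree `2 * d c` are read, and `y∂x`
preserves degree. The last term of one sum and the first of the other vanish, and the rest match
after a shift. -/
lemma lie_f_ofBinaryForm [Finite ι] (hN : IsNaturalBasis h e f d v) (t : IsSl2Triple h e f)
    (c : ι) (P : MvPolynomial (Fin 2) ℂ) :
    ⁅f, ofBinaryForm f d v c P⁆ = ofBinaryForm f d v c (polyF P) := by
  rw [ofBinaryForm, ofBinaryForm, Finset.sum_range_succ, Finset.sum_range_succ', coeff_polyF_zero,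
    lie_add, lie_smul, lie_f_natG, hN.natG_eq_zero t c (Nat.lt_succ_self _), smul_zero, zero_mul,
    zero_smul, lie_sum]
  congr 1
  refine Finset.sum_congr rfl fun j hj => ?_
  have hj' := Finset.mem_range.1 hj
  obtain ⟨k, hk⟩ := Nat.exists_eq_add_of_lt hj'
  rw [lie_smul, lie_f_natG, coeff_polyF_succ, show 2 * d c - j = k + 1 by omega,
    show 2 * d c - (j + 1) = k by omega, Nat.factorial_succ]
  push_cast
  congr 1
  ring

lemma lie_e_ofBinaryForm (hN : IsNaturalBasis h e f d v) (t : IsSl2Triple h e f)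
    (c : ι) (P : MvPolynomial (Fin 2) ℂ) :
    ⁅e, ofBinaryForm f d v c P⁆ = ofBinaryForm f d v c (polyE P) := by
  rw [ofBinaryForm, ofBinaryForm, Finset.sum_range_succ', Finset.sum_range_succ, Nat.sub_self,
    coeff_polyE_zero, lie_add, lie_smul, natG_zero, hN.lie_e, smul_zero, zero_mul, zero_smul,
    lie_sum]
  congr 1
  refine Finset.sum_congr rfl fun j hj => ?_
  have hj' := Finset.mem_range.1 hj
  obtain ⟨k, hk⟩ := Nat.exists_eq_add_of_lt hj'
  have hk' : (2 * d c : ℂ) = j + k + 1 := by exact_mod_cast hk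
  rw [lie_smul, hN.lie_e_natG t, show 2 * d c - j = k + 1 by omega, coeff_polyE_succ,
    show 2 * d c - (j + 1) = k by omega, Nat.factorial_succ, smul_smul, hk', Nat.add_sub_cancel]
  push_cast
  congr 1
  ring

lemma proj_ofBinaryForm_self [Finite ι] (hN : IsNaturalBasis h e f d v) (t : IsSl2Triple h e f)
    (c : ι) (P : MvPolynomial (Fin 2) ℂ) :
    hN.proj c (ofBinaryForm f d v c P) = ofBinaryForm f d v c P := by
  simp only [ofBinaryForm, map_sum, map_smul, hN.proj_natG_self t]

lemma proj_ofBinaryForm_of_ne [Finite ι] (hN : IsNaturalBasis h e f d v)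
    (t : IsSl2Triple h e f) {c i : ι} (hi : i ≠ c) (P : MvPolynomial (Fin 2) ℂ) :
    hN.proj c (ofBinaryForm f d v i P) = 0 := by
  simp [ofBinaryForm, map_sum, map_smul, hN.proj_natG t, hi]

lemma isEquivariantPairing_transvectant [Finite ι] (hN : IsNaturalBasis h e f d v)
    (t : IsSl2Triple h e f) (a b : ℕ) (c : ι) (m : ℕ) :
    IsEquivariantPairing e f a b (fun p q =>
      ofBinaryForm f d v c (transvectant m (stringMonomial a p) (stringMonomial b q))) where
  lie_f p q := by
    rw [hN.lie_f_ofBinaryForm t, polyF_transvectant, polyF_stringMonomial, polyF_stringMonomial,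
      ofBinaryForm_add]
  lie_e p q := by
    rw [hN.lie_e_ofBinaryForm t, polyE_transvectant, polyE_stringMonomial, polyE_stringMonomial,
      ofBinaryForm_add, transvectant_smul_left, transvectant_smul_right, ofBinaryForm_smul,
      ofBinaryForm_smul]
  eq_zero_left p q hp := by
    -- Writing `0` as `0 • 0` gives vanishing from homogeneity.
    rw [stringMonomial, if_neg (by omega), ← zero_smul ℂ (0 : MvPolynomial (Fin 2) ℂ),
      transvectant_smul_left, zero_smul, ofBinaryForm_zero]
  eq_zero_right p q hq := by
    rw [stringMonomial.eq_def b, if_neg (by omega), ← zero_smul ℂ (0 : MvPolynomial (Fin 2) ℂ),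
      transvectant_smul_right, zero_smul, ofBinaryForm_zero]

lemma isEquivariantPairing_proj_lie [Finite ι] (hN : IsNaturalBasis h e f d v)
    (t : IsSl2Triple h e f) (a b c : ι) :
    IsEquivariantPairing e f (d a) (d b)
      (fun p q => hN.proj c ⁅natG f v a p, natG f v b q⁆) where
  lie_f p q := by
    rw [← hN.proj_lie_f t, leibniz_lie, lie_f_natG, lie_f_natG, map_add]
  lie_e p q := by
    rw [← hN.proj_lie_e t, leibniz_lie, hN.lie_e_natG t, hN.lie_e_natG t, smul_lie, lie_smul,
      map_add, map_smul, map_smul]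
  eq_zero_left p q hp := by
    rw [hN.natG_eq_zero t a hp, zero_lie, map_zero]
  eq_zero_right p q hq := by
    rw [hN.natG_eq_zero t b hq, lie_zero, map_zero]

lemma exists_proj_lie_eq [Fintype ι] (hN : IsNaturalBasis h e f d v) (t : IsSl2Triple h e f)
    (a b c : ι) :
    ∃ ω : ℂ, (¬ (d c ≤ d a + d b ∧ d a ≤ d b + d c ∧ d b ≤ d a + d c) → ω = 0) ∧
      ∀ p ≤ 2 * d a, ∀ q ≤ 2 * d b, hN.proj c ⁅natG f v a p, natG f v b q⁆ =
        ω • ofBinaryForm f d v c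
          (transvectant (d a + d b - d c) (natMonomial (d a) p) (natMonomial (d b) q)) := by
  have hB := hN.isEquivariantPairing_proj_lie t a b c
  have hBc : ∀ p q, hN.proj c (hN.proj c ⁅natG f v a p, natG f v b q⁆) =
    hN.proj c ⁅natG f v a p, natG f v b q⁆ := fun p q => hN.proj_proj t c _
  by_cases hT : d c ≤ d a + d b ∧ d a ≤ d b + d c ∧ d b ≤ d a + d c
  · set m := d a + d b - d c with hm
    have hTr := hN.isEquivariantPairing_transvectant t (d a) (d b) c m
    obtain ⟨τ, hτ, hτm⟩ := exists_ofBinaryForm_transvectant_eq f d v hT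
    obtain ⟨κ, hκ, -⟩ := hB.row_highest hN t hBc (q := m)
      (fun q' hq' => hB.row_eq_zero_of_lt hN t hBc (by omega))
    -- The scalar `κ / τ` makes the difference of the two pairings vanish at the decisive entry `(0,
    -- m)`, hence everywhere.
    have hD : IsEquivariantPairing e f (d a) (d b) (fun p q =>
        hN.proj c ⁅natG f v a p, natG f v b q⁆ - (κ / τ) • ofBinaryForm f d v c
          (transvectant m (stringMonomial (d a) p) (stringMonomial (d b) q))) :=
      { lie_f := fun p q => by
          rw [lie_sub, lie_smul, hB.lie_f, hTr.lie_f, smul_add]; abel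
        lie_e := fun p q => by
          rw [lie_sub, lie_smul, hB.lie_e, hTr.lie_e]; module
        eq_zero_left := fun p q hp => by
          rw [hB.eq_zero_left p q hp, hTr.eq_zero_left p q hp, smul_zero, sub_zero]
        eq_zero_right := fun p q hp => by
          rw [hB.eq_zero_right p q hp, hTr.eq_zero_right p q hp, smul_zero, sub_zero] }
    refine ⟨κ / τ, fun hn => absurd hT hn, fun p hp q hq => ?_⟩
    have h0 := hD.eq_zero_of_row_eq_zero hN t (c := c)
      (fun p q => by rw [map_sub, map_smul, hBc, hN.proj_ofBinaryForm_self t])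
      (fun m' hm' => by
        obtain rfl : m' = m := by omega
        rw [hκ, stringMonomial, stringMonomial, if_pos (by omega), if_pos (by omega), hτm,
          smul_smul, div_mul_cancel₀ _ hτ, sub_self]) p q
    rw [stringMonomial, stringMonomial, if_pos hp, if_pos hq] at h0
    exact sub_eq_zero.1 h0
  · exact ⟨0, fun _ => rfl, fun p _ q _ => by
      rw [hB.eq_zero_of_not_triangle hN t hBc hT, zero_smul]⟩

end IsNaturalBasis

theorem IsStructureConstants.proj_lie_eq [Fintype ι] {ω : ι → ι → ι → ℂ}
    (hω : IsStructureConstants h e f d v ω) (t : IsSl2Triple h e f) (a b c : ι) {p q : ℕ}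
    (hp : p ≤ 2 * d a) (hq : q ≤ 2 * d b) :
    hω.natural.proj c ⁅natG f v a p, natG f v b q⁆ = ω a b c • ofBinaryForm f d v c
      (transvectant (d a + d b - d c) (natMonomial (d a) p) (natMonomial (d b) q)) := by
  rw [hω.lie_eq a b p hp q hq, map_sum, Finset.sum_eq_single c, map_smul,
    hω.natural.proj_ofBinaryForm_self t]
  · intro i _ hi
    rw [map_smul, hω.natural.proj_ofBinaryForm_of_ne t hi, smul_zero]
  · simp

/-- Structure constants exist and are unique. -/
theorem IsNaturalBasis.exists_structureConstants [Fintype ι] (hN : IsNaturalBasis h e f d v)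
    (t : IsSl2Triple h e f) :
    ∃ ω₀, ∀ ω, IsStructureConstants h e f d v ω ↔ ω = ω₀ := by
  choose ω₀ h0 h1 using hN.exists_proj_lie_eq t
  have hω₀ : IsStructureConstants h e f d v ω₀ :=
    ⟨hN, h0, fun a b p hp q hq => by
      rw [← hN.sum_proj t ⁅natG f v a p, natG f v b q⁆]
      exact Finset.sum_congr rfl fun c _ => h1 a b c p hp q hq⟩
  refine ⟨ω₀, fun ω => ⟨fun hω => ?_, fun hω => hω ▸ hω₀⟩⟩
  funext a b c
  by_cases hT : d c ≤ d a + d b ∧ d a ≤ d b + d c ∧ d b ≤ d a + d c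
  -- The constant can be read off at `p = 0`, `q = d a + d b - d c`, where the transvectant gives `τ
  -- • v c` with `τ ≠ 0`.
  · obtain ⟨τ, hτ, hτm⟩ := exists_ofBinaryForm_transvectant_eq f d v hT
    have e1 := hω.proj_lie_eq t a b c (p := 0) (q := d a + d b - d c) (by omega) (by omega)
    have e2 := hω₀.proj_lie_eq t a b c (p := 0) (q := d a + d b - d c) (by omega) (by omega)
    have e3 := e1.symm.trans e2
    rw [hτm, smul_smul, smul_smul] at e3
    exact mul_right_cancel₀ hτ (smul_left_injective ℂ (hN.ne_zero c) e3)
  · rw [hω.eq_zero a b c hT, h0 a b c hT]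

end BinaryForms

/-! ### Comparison of structure constants -/

section Comparison

variable {L₁ L₂ : Type*} [LieRing L₁] [LieAlgebra ℂ L₁] [LieRing L₂] [LieAlgebra ℂ L₂]
  {ι₁ ι₂ κ : Type*} [Fintype ι₁] [Fintype ι₂] [Fintype κ]
  {h₁ e₁ f₁ : L₁} {d₁ : ι₁ → ℕ} {v₁ : ι₁ → L₁} {ω₁ : ι₁ → ι₁ → ι₁ → ℂ}
  {h₂ e₂ f₂ : L₂} {d₂ : ι₂ → ℕ} {v₂ : ι₂ → L₂} {ω₂ : ι₂ → ι₂ → ι₂ → ℂ}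

lemma mk_sum_mem (S : Submodule ℂ (L₁ × L₂)) {α : Type*} (A : Finset α) (x : α → L₁) (y : α → L₂)
    (hS : ∀ i ∈ A, (x i, y i) ∈ S) : (∑ i ∈ A, x i, ∑ i ∈ A, y i) ∈ S := by
  have h : (∑ i ∈ A, x i, ∑ i ∈ A, y i) = ∑ i ∈ A, (x i, y i) :=
    Prod.ext (by rw [Prod.fst_sum]) (by rw [Prod.snd_sum])
  rw [h]
  exact S.sum_mem hS

/-- Comparison of structure constants along a correspondence `S` between two Lie algebras that is
compatible with the bracket and relates the highest weight vectors up to scalars. -/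
theorem IsStructureConstants.eq_of_correspondence
    (H₁ : IsStructureConstants h₁ e₁ f₁ d₁ v₁ ω₁) (H₂ : IsStructureConstants h₂ e₂ f₂ d₂ v₂ ω₂)
    (t₂ : IsSl2Triple h₂ e₂ f₂) (S : Submodule ℂ (L₁ × L₂))
    (hlie : ∀ x ∈ S, ∀ y ∈ S, (⁅x.1, y.1⁆, ⁅x.2, y.2⁆) ∈ S)
    (hinj : ∀ y, ((0 : L₁), y) ∈ S → y = 0)
    (σ₁ : κ → ι₁) (hσ₁ : Function.Injective σ₁) (σ₂ : κ → ι₂) (hσ₂ : Function.Injective σ₂)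
    (hd : ∀ i, d₁ (σ₁ i) = d₂ (σ₂ i)) (s : κ → ℂ) (hf : (f₁, f₂) ∈ S)
    (hv : ∀ i, (v₁ (σ₁ i), s i • v₂ (σ₂ i)) ∈ S)
    (hoff : ∀ i j c, c ∉ Set.range σ₁ → ω₁ (σ₁ i) (σ₁ j) c = 0) (i j k : κ) :
    s i * s j * ω₂ (σ₂ i) (σ₂ j) (σ₂ k) = s k * ω₁ (σ₁ i) (σ₁ j) (σ₁ k) := by
  classical
  have hG : ∀ i p, (natG f₁ v₁ (σ₁ i) p, s i • natG f₂ v₂ (σ₂ i) p) ∈ S := by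
    intro i p
    induction p with
    | zero => simpa using hv i
    | succ p ih =>
      have := hlie _ hf _ ih
      rwa [lie_smul, lie_f_natG, lie_f_natG] at this
  -- The same binary form has the same coefficients along both related strings.
  have hoB : ∀ k P, (ofBinaryForm f₁ d₁ v₁ (σ₁ k) P, s k • ofBinaryForm f₂ d₂ v₂ (σ₂ k) P) ∈ S := by
    intro k P
    rw [ofBinaryForm, ofBinaryForm, hd, Finset.smul_sum]
    refine mk_sum_mem S _ _ _ fun p _ => ?_
    rw [smul_comm]
    exact S.smul_mem _ (hG k p)
  by_cases hT : d₂ (σ₂ k) ≤ d₂ (σ₂ i) + d₂ (σ₂ j) ∧ d₂ (σ₂ i) ≤ d₂ (σ₂ j) + d₂ (σ₂ k) ∧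
      d₂ (σ₂ j) ≤ d₂ (σ₂ i) + d₂ (σ₂ k)
  · set m := d₂ (σ₂ i) + d₂ (σ₂ j) - d₂ (σ₂ k) with hm
    obtain ⟨τ, hτ, hτm⟩ := exists_ofBinaryForm_transvectant_eq f₂ d₂ v₂ hT
    have hbr : (⁅natG f₁ v₁ (σ₁ i) 0, natG f₁ v₁ (σ₁ j) m⁆,
        (s i * s j) • ⁅natG f₂ v₂ (σ₂ i) 0, natG f₂ v₂ (σ₂ j) m⁆) ∈ S := by
      have := hlie _ (hG i 0) _ (hG j m)
      rwa [smul_lie, lie_smul, smul_smul] at this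
    set T₂ : κ → L₂ := fun c => ofBinaryForm f₂ d₂ v₂ (σ₂ c)
      (transvectant (d₂ (σ₂ i) + d₂ (σ₂ j) - d₂ (σ₂ c)) (natMonomial (d₂ (σ₂ i)) 0)
        (natMonomial (d₂ (σ₂ j)) m)) with hT₂
    -- The first component equals that of `hbr`, so subtracting the two pairs and using `hinj`
    -- identifies the second components. By `hoff`, only summands indexed by `κ` enter the
    -- expansion.
    have hsum : (⁅natG f₁ v₁ (σ₁ i) 0, natG f₁ v₁ (σ₁ j) m⁆,
        ∑ c, (ω₁ (σ₁ i) (σ₁ j) (σ₁ c) * s c) • T₂ c) ∈ S := by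
      rw [H₁.lie_eq _ _ 0 (Nat.zero_le _) m (by rw [hd]; omega),
        ← Finset.sum_subset (Finset.subset_univ (Finset.univ.map ⟨σ₁, hσ₁⟩)), Finset.sum_map]
      · refine mk_sum_mem S _ _ _ fun c _ => ?_
        rw [mul_smul]
        have := S.smul_mem (ω₁ (σ₁ i) (σ₁ j) (σ₁ c)) (hoB c
          (transvectant (d₁ (σ₁ i) + d₁ (σ₁ j) - d₁ (σ₁ c)) (natMonomial (d₁ (σ₁ i)) 0)
            (natMonomial (d₁ (σ₁ j)) m)))
        simp only [hT₂, ← hd]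
        exact this
      · intro c _ hc
        rw [hoff i j c (by simpa using hc), zero_smul]
    have hz := hinj _ (by
      have := S.sub_mem hbr hsum
      rwa [Prod.mk_sub_mk, sub_self] at this)
    rw [sub_eq_zero] at hz
    have hz2 := congrArg (H₂.natural.proj (σ₂ k)) hz
    rw [map_smul, H₂.proj_lie_eq t₂ _ _ _ (by omega) (by omega), map_sum,
      Finset.sum_eq_single k, map_smul, H₂.natural.proj_ofBinaryForm_self t₂, hτm, smul_smul,
      smul_smul, smul_smul] at hz2
    · have := smul_left_injective ℂ (H₂.natural.ne_zero _) hz2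
      exact mul_right_cancel₀ hτ (this.trans (by ring))
    · intro c _ hc
      rw [map_smul, H₂.natural.proj_ofBinaryForm_of_ne t₂ (hσ₂.ne hc), smul_zero]
    · simp
  · rw [H₂.eq_zero _ _ _ hT, H₁.eq_zero _ _ _ (by rwa [hd, hd, hd]), mul_zero, mul_zero]

end Comparison

/-! ### Centralizers of nilpotent matrices -/

section Centralizers

open Matrix

variable {m : Type*} [Fintype m] [DecidableEq m] {e : Matrix m m ℂ} {s : ℕ}

/-- The sum `∑ e ^ i * w φᵀ * e ^ (s - i)`; it commutes with `e` if `e ^ (s + 1) = 0`. -/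
noncomputable def rankOneSum (e : Matrix m m ℂ) (s : ℕ) :
    (m → ℂ) →ₗ[ℂ] (m → ℂ) →ₗ[ℂ] Matrix m m ℂ :=
  LinearMap.mk₂ ℂ (fun w φ => ∑ i ∈ Finset.range (s + 1), e ^ i * vecMulVec w φ * e ^ (s - i))
    (fun w w' φ => by simp only [add_vecMulVec, mul_add, add_mul, Finset.sum_add_distrib])
    (fun c w φ => by simp only [smul_vecMulVec, mul_smul_comm, smul_mul_assoc, Finset.smul_sum])
    (fun w φ φ' => by simp only [vecMulVec_add, mul_add, add_mul, Finset.sum_add_distrib])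
    (fun c w φ => by simp only [vecMulVec_smul, mul_smul_comm, smul_mul_assoc, Finset.smul_sum])

lemma rankOneSum_apply (e : Matrix m m ℂ) (s : ℕ) (w φ : m → ℂ) :
    rankOneSum e s w φ = ∑ i ∈ Finset.range (s + 1), e ^ i * vecMulVec w φ * e ^ (s - i) := rfl

/-- The commutator telescopes to its two end terms, each containing `e ^ (s + 1)`. -/
lemma commute_rankOneSum (he : e ^ (s + 1) = 0) (w φ : m → ℂ) :
    Commute e (rankOneSum e s w φ) := by
  rw [commute_iff_eq, rankOneSum_apply, Finset.mul_sum, Finset.sum_mul, Finset.sum_range_succ,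
    Finset.sum_range_succ']
  have h1 : e * (e ^ s * vecMulVec w φ * e ^ (s - s)) = 0 := by
    rw [← mul_assoc, ← mul_assoc, ← pow_succ', he, zero_mul, zero_mul]
  have h2 : e ^ 0 * vecMulVec w φ * e ^ (s - 0) * e = 0 := by
    rw [mul_assoc, ← pow_succ, Nat.sub_zero, he, mul_zero]
  rw [h1, h2]
  congr 1
  refine Finset.sum_congr rfl fun i hi => ?_
  have hi' := Finset.mem_range.1 hi
  rw [← mul_assoc, ← mul_assoc, ← pow_succ', mul_assoc _ _ e, ← pow_succ,
    show s - (i + 1) + 1 = s - i by omega]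

lemma rankOneSum_mulVec (e : Matrix m m ℂ) (s : ℕ) (w φ u : m → ℂ) :
    rankOneSum e s w φ *ᵥ u =
      ∑ i ∈ Finset.range (s + 1), (φ ⬝ᵥ (e ^ (s - i) *ᵥ u)) • (e ^ i *ᵥ w) := by
  rw [rankOneSum_apply, Matrix.sum_mulVec]
  refine Finset.sum_congr rfl fun i _ => ?_
  rw [← mulVec_mulVec, ← mulVec_mulVec, vecMulVec_mulVec, op_smul_eq_smul, mulVec_smul]

/-- A vector and a covector that are dual for the nilpotent matrix `e`. -/
lemma exists_dual_vectors (he : e ^ (s + 1) = 0) (hs : e ^ s ≠ 0) :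
    ∃ φ u : m → ℂ, ∀ j ≤ s, φ ⬝ᵥ (e ^ j *ᵥ u) = if j = s then 1 else 0 := by
  obtain ⟨i, k, hik⟩ : ∃ i k, (e ^ s) i k ≠ 0 := by
    by_contra! hcon
    exact hs (by ext i k; exact hcon i k)
  refine ⟨Pi.single i 1, ?_⟩
  set φ : m → ℂ := Pi.single i 1
  -- Descending correction: subtracting a multiple of `e ^ (t + 1) u` clears the pairing at `j = s -
  -- 1 - t`. Those at larger `j` are undisturbed, since `e ^ (j + t + 1) = 0` there.
  have key : ∀ t ≤ s, ∃ u : m → ℂ, φ ⬝ᵥ (e ^ s *ᵥ u) = 1 ∧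
      ∀ j, s ≤ j + t → j < s → φ ⬝ᵥ (e ^ j *ᵥ u) = 0 := by
    intro t
    induction t with
    | zero =>
      intro _
      refine ⟨Pi.single k ((e ^ s) i k)⁻¹, ?_, fun j h1 h2 => absurd h1 (by omega)⟩
      simp [φ, hik]
    | succ t ih =>
      intro ht
      obtain ⟨u, hu1, hu2⟩ := ih (by omega)
      have hz : ∀ j, s < j → e ^ j = 0 := fun j hj => pow_eq_zero_of_le hj he
      refine ⟨u - (φ ⬝ᵥ (e ^ (s - 1 - t) *ᵥ u)) • (e ^ (t + 1) *ᵥ u), ?_, fun j h1 h2 => ?_⟩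
      · rw [mulVec_sub, mulVec_smul, mulVec_mulVec, ← pow_add, hz (s + (t + 1)) (by omega)]
        simpa using hu1
      · rw [mulVec_sub, mulVec_smul, mulVec_mulVec, ← pow_add, dotProduct_sub, dotProduct_smul]
        by_cases hj : s ≤ j + t
        · rw [hz (j + (t + 1)) (by omega), hu2 j hj h2]
          simp
        · rw [show j + (t + 1) = s by omega, hu1, show s - 1 - t = j by omega]
          simp
  obtain ⟨u, h1, h2⟩ := key s le_rfl
  refine ⟨u, fun j hj => ?_⟩
  split_ifs with hjs
  · rw [hjs, h1]
  · exact h2 j (by omega) (by omega)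

lemma rankOneSum_mulVec_dual {φ u : m → ℂ}
    (hu : ∀ j ≤ s, φ ⬝ᵥ (e ^ j *ᵥ u) = if j = s then 1 else 0) (w : m → ℂ) :
    rankOneSum e s w φ *ᵥ u = w := by
  rw [rankOneSum_mulVec, Finset.sum_eq_single 0]
  · simp [hu s le_rfl]
  · intro i hi h0
    have hi' := Finset.mem_range.1 hi
    rw [hu _ (by omega), if_neg (by omega), zero_smul]
  · simp

/-- If `e` is nilpotent but not regular, the traceless matrices that commute with `e` contain a
subspace of dimension the size of `e`. -/
lemma exists_traceless_commuting (he : e ^ (s + 1) = 0) (hs : e ^ s ≠ 0)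
    (hcard : s + 1 < Fintype.card m) :
    ∃ ψ : (m → ℂ) →ₗ[ℂ] Matrix m m ℂ, Function.Injective ψ ∧
      ∀ w, Commute e (ψ w) ∧ (ψ w).trace = 0 := by
  obtain ⟨φ, u, hu⟩ := exists_dual_vectors he hs
  have hN : (Fintype.card m : ℂ) ≠ 0 := Nat.cast_ne_zero.2 (by omega)
  set B : (m → ℂ) →ₗ[ℂ] Matrix m m ℂ := (rankOneSum e s).flip φ with hB
  have hBw : ∀ w, B w = rankOneSum e s w φ := fun w => rfl
  refine ⟨B - ((Fintype.card m : ℂ)⁻¹ • Matrix.traceLinearMap m ℂ ℂ ∘ₗ B).smulRight 1, ?_,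
    fun w => ⟨?_, ?_⟩⟩
  · rw [injective_iff_map_eq_zero]
    intro w hw
    set c := (Fintype.card m : ℂ)⁻¹ * (B w).trace with hc
    have hw' : B w = c • (1 : Matrix m m ℂ) := by
      simpa [sub_eq_zero, hc] using hw
    -- As `s + 1` is less than the size, some `x ≠ 0` satisfies `φ (e ^ j x) = 0` for all `j ≤ s`.
    -- Then `B w` kills `x`, so it can be scalar only if it is zero.
    let ev : (m → ℂ) →ₗ[ℂ] (Fin (s + 1) → ℂ) :=
      LinearMap.pi fun j => (dotProductBilin ℂ ℂ φ) ∘ₗ (e ^ (j : ℕ)).mulVecLin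
    have hker : LinearMap.ker ev ≠ ⊥ := by
      apply LinearMap.ker_ne_bot_of_finrank_lt
      simpa using hcard
    obtain ⟨x, hx, hx0⟩ := Submodule.exists_mem_ne_zero_of_ne_bot hker
    have hxj : ∀ j ≤ s, φ ⬝ᵥ (e ^ j *ᵥ x) = 0 := fun j hj =>
      congrFun (LinearMap.mem_ker.1 hx) ⟨j, by omega⟩
    have h1 : B w *ᵥ x = 0 := by
      rw [hBw, rankOneSum_mulVec]
      exact Finset.sum_eq_zero fun i _ => by rw [hxj _ (Nat.sub_le _ _), zero_smul]
    rw [hw', smul_mulVec, one_mulVec] at h1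
    have hc0 : c = 0 := (smul_eq_zero.1 h1).resolve_right hx0
    rw [hc0, zero_smul] at hw'
    rw [← rankOneSum_mulVec_dual hu w, ← hBw, hw', zero_mulVec]
  · have h1 : Commute e (B w) := commute_rankOneSum he w φ
    simpa using h1.sub_right ((Commute.one_right e).smul_right _)
  · simp
    field_simp
    ring

/-- The skew-symmetric matrices that commute with a skew-symmetric nilpotent `e`. -/
lemma exists_skew_commuting (hskew : eᵀ = -e) (he : e ^ (s + 1) = 0) (hs : e ^ s ≠ 0) :
    ∃ Ψ : (m → ℂ) →ₗ[ℂ] Matrix m m ℂ, Module.finrank ℂ (LinearMap.ker Ψ) ≤ s / 2 + 1 ∧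
      ∀ w, Commute e (Ψ w) ∧ (Ψ w)ᵀ = -Ψ w := by
  obtain ⟨φ, u, hu⟩ := exists_dual_vectors he hs
  have hpow : ∀ k, (e ^ k)ᵀ = (-1 : ℂ) ^ k • e ^ k := by
    intro k
    rw [transpose_pow, hskew, neg_pow]
    rcases Nat.even_or_odd k with hk | hk <;> simp [hk.neg_one_pow]
  have htr : ∀ w, (rankOneSum e s w φ)ᵀ = (-1 : ℂ) ^ s • rankOneSum e s φ w := by
    intro w
    rw [rankOneSum_apply, rankOneSum_apply, transpose_sum, ← Finset.sum_range_reflect,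
      Finset.smul_sum]
    refine Finset.sum_congr rfl fun i hi => ?_
    have hi' := Finset.mem_range.1 hi
    rw [transpose_mul, transpose_mul, transpose_vecMulVec, hpow, hpow,
      show s - (s + 1 - 1 - i) = i by omega, show s + 1 - 1 - i = s - i by omega, smul_mul_assoc,
      mul_smul_comm, mul_smul_comm, smul_smul, ← pow_add, show i + (s - i) = s by omega, mul_assoc]
  -- By `htr` this is the difference of a matrix and its transpose.
  refine ⟨(rankOneSum e s).flip φ - (-1 : ℂ) ^ s • rankOneSum e s φ, ?_, fun w => ⟨?_, ?_⟩⟩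
  · set Ψ := (rankOneSum e s).flip φ - (-1 : ℂ) ^ s • rankOneSum e s φ with hΨ
    have hΨw : ∀ w, Ψ w = rankOneSum e s w φ - (-1 : ℂ) ^ s • rankOneSum e s φ w := fun w => rfl
    have hΨu : ∀ k, Ψ (e ^ k *ᵥ φ) *ᵥ u = (1 - (-1 : ℂ) ^ (s + k)) • (e ^ k *ᵥ φ) := by
      intro k
      have h1 : rankOneSum e s φ (e ^ k *ᵥ φ) = (-1 : ℂ) ^ k • (e ^ k * rankOneSum e s φ φ) := by
        have h2 : vecMulVec φ (e ^ k *ᵥ φ) = (-1 : ℂ) ^ k • (vecMulVec φ φ * e ^ k) := by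
          rw [vecMulVec_mul, ← mulVec_transpose, hpow, smul_mulVec, vecMulVec_smul, smul_smul,
            ← mul_pow]
          simp
        rw [((commute_rankOneSum he φ φ).pow_left k).eq, rankOneSum_apply, rankOneSum_apply,
          Finset.sum_mul, Finset.smul_sum]
        refine Finset.sum_congr rfl fun i _ => ?_
        rw [h2, mul_smul_comm, smul_mul_assoc, mul_assoc, mul_assoc, mul_assoc, mul_assoc,
          ← pow_add, ← pow_add, add_comm]
      rw [hΨw, sub_mulVec, rankOneSum_mulVec_dual hu, h1, smul_mulVec, smul_mulVec, ← mulVec_mulVec,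
        rankOneSum_mulVec_dual hu, smul_smul, ← pow_add, sub_smul, one_smul]
    have hle : LinearMap.ker Ψ ≤
        Submodule.span ℂ (Set.range fun j : Fin (s / 2 + 1) => e ^ (s - 2 * (j : ℕ)) *ᵥ φ) := by
      intro w hw
      have hw0 : Ψ w *ᵥ u = 0 := by rw [LinearMap.mem_ker.1 hw, zero_mulVec]
      -- Applying `Ψ w = 0` to the dual vector `u` puts `w` in the span of the `e ^ k φ`. A second
      -- application, now to this expansion, removes the terms with `s + k` odd, leaving `s / 2 + 1`
      -- spanning vectors.
      obtain ⟨p, hp⟩ : ∃ p : ℕ → ℂ, w = ∑ k ∈ Finset.range (s + 1), p k • (e ^ k *ᵥ φ) := by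
        refine ⟨fun k => (-1 : ℂ) ^ s * (w ⬝ᵥ (e ^ (s - k) *ᵥ u)), ?_⟩
        rw [hΨw, sub_mulVec, rankOneSum_mulVec_dual hu, smul_mulVec, rankOneSum_mulVec,
          sub_eq_zero, Finset.smul_sum] at hw0
        simpa only [smul_smul] using hw0
      have h1 : ∑ k ∈ Finset.range (s + 1),
          (p k * (1 - (-1 : ℂ) ^ (s + k))) • (e ^ k *ᵥ φ) = 0 := by
        rw [← hw0, hp, map_sum, Matrix.sum_mulVec]
        refine Finset.sum_congr rfl fun k _ => ?_
        rw [map_smul, smul_mulVec, hΨu, smul_smul]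
      have h2 : w = ∑ k ∈ Finset.range (s + 1),
          (p k * ((1 + (-1 : ℂ) ^ (s + k)) / 2)) • (e ^ k *ᵥ φ) := by
        rw [hp, ← sub_eq_zero, ← Finset.sum_sub_distrib]
        refine Eq.trans ?_ ((congrArg (fun x => (1 / 2 : ℂ) • x) h1).trans (smul_zero _))
        simp only [Finset.smul_sum]
        refine Finset.sum_congr rfl fun k _ => ?_
        module
      rw [h2]
      refine Submodule.sum_mem _ fun k hk => ?_
      have hk' := Finset.mem_range.1 hk
      rcases Nat.even_or_odd (s + k) with hpar | hpar
      · refine Submodule.smul_mem _ _ (Submodule.subset_span ⟨⟨(s - k) / 2, by omega⟩, ?_⟩)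
        obtain ⟨r, hr⟩ := hpar
        simp only
        rw [show s - 2 * ((s - k) / 2) = k by omega]
      · rw [hpar.neg_one_pow]
        simp
    refine (Submodule.finrank_mono hle).trans ((finrank_range_le_card _).trans ?_)
    simp
  · change Commute e (rankOneSum e s w φ - (-1 : ℂ) ^ s • rankOneSum e s φ w)
    exact (commute_rankOneSum he w φ).sub_right ((commute_rankOneSum he φ w).smul_right _)
  · have h1 := htr w
    have h2 : (rankOneSum e s φ w)ᵀ = (-1 : ℂ) ^ s • rankOneSum e s w φ := by
      have := congrArg transpose h1
      rw [transpose_transpose, transpose_smul] at this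
      rw [this, smul_smul, ← mul_pow]
      simp
    simp only [LinearMap.sub_apply, LinearMap.smul_apply, LinearMap.flip_apply, transpose_sub,
      transpose_smul, h1, h2, smul_smul, ← mul_pow]
    simp

lemma pow_card_eq_zero_of_isNilpotent (he : IsNilpotent e) : e ^ Fintype.card m = 0 := by
  have h1 := Matrix.isNilpotent_charpoly_sub_pow_of_isNilpotent he
  have h2 : e.charpoly = Polynomial.X ^ Fintype.card m := sub_eq_zero.1 h1.eq_zero
  have h3 := Matrix.aeval_self_charpoly e
  rwa [h2, map_pow, Polynomial.aeval_X] at h3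

/-- Otherwise the powers `e ^ k` would be eigenvectors of `ad h` with infinitely many eigenvalues
`2k`. -/
lemma isNilpotent_of_commutator_eq {N : ℕ} {h e : Matrix (Fin N) (Fin N) ℂ}
    (H : h * e - e * h = 2 • e) : IsNilpotent e := by
  by_contra hn
  let A : Module.End ℂ (Matrix (Fin N) (Fin N) ℂ) := LinearMap.mulLeft ℂ h - LinearMap.mulRight ℂ h
  have hinf : (Set.range fun k : ℕ => 2 * (k : ℂ)).Infinite :=
    Set.infinite_range_of_injective fun a b hab => by simpa using hab
  refine hinf (A.finite_hasEigenvalue.subset ?_)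
  rintro _ ⟨k, rfl⟩
  refine Module.End.hasEigenvalue_of_hasEigenvector (x := e ^ k) ⟨?_, fun h0 => hn ⟨k, h0⟩⟩
  rw [Module.End.mem_eigenspace_iff]
  simpa [A] using lie_pow_of_lie_eq_two H k

/-- The nilpotency degree. -/
lemma exists_pow_ne_zero_pow_succ_eq_zero [Nonempty m] (he : IsNilpotent e) :
    ∃ s, e ^ s ≠ 0 ∧ e ^ (s + 1) = 0 := by
  obtain ⟨k, hk⟩ := he
  exact Nat.exists_not_and_succ_of_not_zero_of_exists (p := fun k => e ^ k = 0) (by simp) ⟨k, hk⟩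

end Centralizers

/-! ### Principal triples have regular nilpotent elements -/

section Principal

open Matrix

lemma commutator_h_e {N : ℕ} {K : LieSubalgebra ℂ (Matrix (Fin N) (Fin N) ℂ)} {h e f : K}
    (t : IsSl2Triple h e f) : h.1 * e.1 - e.1 * h.1 = 2 • e.1 := by
  have := congrArg Subtype.val t.lie_h_e_nsmul
  simpa [Ring.lie_def] using this

/-- The nilpotent element of a principal triple of `sl_N` is a regular nilpotent matrix. -/
theorem pow_ne_zero_of_isPrincipal_sl {N : ℕ} (hN : 2 ≤ N)
    {h e f : LieAlgebra.SpecialLinear.sl (Fin N) ℂ} (t : IsPrincipalSl2Triple (N - 1) h e f) :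
    e.1 ^ (N - 1) ≠ 0 := by
  have : Nonempty (Fin N) := ⟨⟨0, by omega⟩⟩
  have hnil := isNilpotent_of_commutator_eq (commutator_h_e t.triple)
  obtain ⟨s, hs, hs1⟩ := exists_pow_ne_zero_pow_succ_eq_zero hnil
  intro h0
  have hsN : s + 1 < Fintype.card (Fin N) := by
    rw [Fintype.card_fin]
    by_contra hlt
    exact hs (pow_eq_zero_of_le (by omega) h0)
  obtain ⟨ψ, hinj, hψ⟩ := exists_traceless_commuting hs1 hs hsN
  let ψ' : (Fin N → ℂ) →ₗ[ℂ]
      LinearMap.ker (LieAlgebra.ad ℂ (LieAlgebra.SpecialLinear.sl (Fin N) ℂ) e) :=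
    { toFun := fun w => ⟨⟨ψ w, LinearMap.mem_ker.2 (hψ w).2⟩, LinearMap.mem_ker.2
        (Subtype.ext (sub_eq_zero.2 (hψ w).1.eq))⟩
      map_add' := fun x y => by ext1; ext1; exact map_add ψ x y
      map_smul' := fun c x => by ext1; ext1; exact map_smul ψ c x }
  have hle := LinearMap.finrank_le_finrank_of_injective (f := ψ') fun x y hxy =>
    hinj (congrArg (fun z => z.1.1) hxy)
  rw [t.finrank_centralizer, Module.finrank_fin_fun] at hle
  omega

/-- The nilpotent element of a principal triple of `so_{2n-1}` is a regular nilpotent matrix. -/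
theorem pow_ne_zero_of_isPrincipal_so {n : ℕ} (hn : 2 ≤ n)
    {h e f : LieAlgebra.Orthogonal.so (Fin (2 * n - 1)) ℂ}
    (t : IsPrincipalSl2Triple (n - 1) h e f) : e.1 ^ (2 * n - 2) ≠ 0 := by
  have : Nonempty (Fin (2 * n - 1)) := ⟨⟨0, by omega⟩⟩
  have hnil := isNilpotent_of_commutator_eq (commutator_h_e t.triple)
  obtain ⟨s, hs, hs1⟩ := exists_pow_ne_zero_pow_succ_eq_zero hnil
  intro h0
  have hsN : s < 2 * n - 2 := by
    by_contra hlt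
    exact hs (pow_eq_zero_of_le (by omega) h0)
  obtain ⟨Ψ, hker, hΨ⟩ := exists_skew_commuting
    ((LieAlgebra.Orthogonal.mem_so _ _ _).1 e.2) hs1 hs
  let ψ : LinearMap.range Ψ →ₗ[ℂ]
      LinearMap.ker (LieAlgebra.ad ℂ (LieAlgebra.Orthogonal.so (Fin (2 * n - 1)) ℂ) e) :=
    { toFun := fun w => ⟨⟨w.1, (LieAlgebra.Orthogonal.mem_so _ _ _).2 (by
        obtain ⟨_, x, rfl⟩ := w; exact (hΨ x).2)⟩, LinearMap.mem_ker.2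
        (Subtype.ext (sub_eq_zero.2 (by obtain ⟨_, x, rfl⟩ := w; exact (hΨ x).1.eq)))⟩
      map_add' := fun x y => rfl
      map_smul' := fun c x => rfl }
  have hle := LinearMap.finrank_le_finrank_of_injective (f := ψ) fun x y hxy =>
    Subtype.ext (congrArg (fun z => z.1.1) hxy)
  -- From `s ≤ 2n - 3` the kernel has dimension at most `n - 1`. The range then has dimension at
  -- least `n`, exceeding the rank `n - 1`.
  have hrn := LinearMap.finrank_range_add_finrank_ker Ψ
  rw [t.finrank_centralizer] at hle
  rw [Module.finrank_fin_fun] at hrn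
  omega

end Principal

/-! ### Irreducible representations and intertwiners -/

section Representations

open Matrix

section EndStrings

variable {U U' : Type*} [AddCommGroup U] [Module ℂ U]
  [AddCommGroup U'] [Module ℂ U']
  {h e f : Module.End ℂ U} {h' e' f' : Module.End ℂ U'}

lemma linearIndependent_string (t : IsSl2Triple h e f) {v : U} {n : ℕ} (hv : v ≠ 0)
    (hh : h v = (n : ℂ) • v) (he : e v = 0) :
    LinearIndependent ℂ (fun j : Fin (n + 1) => (f ^ (j : ℕ)) v) := by
  have := linearIndependent_strings (M := U) t (ι := Unit) (d := fun _ => n) (v := fun _ => v)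
    (LinearIndependent.of_subsingleton () hv) (fun _ => hh) (fun _ => he)
  exact this.comp (fun j : Fin (n + 1) => (⟨(), j⟩ : (_ : Unit) × Fin (n + 1)))
    (fun a b hab => by simpa using hab)

lemma exists_nat_weight [Module.Finite ℂ U] (t : IsSl2Triple h e f) {v : U} {μ : ℂ} (hv : v ≠ 0)
    (hh : h v = μ • v) (he : e v = 0) : ∃ n : ℕ, μ = n ∧ n + 1 ≤ Module.finrank ℂ U := by
  obtain ⟨n, rfl⟩ := IsSl2Triple.HasPrimitiveVectorWith.exists_nat (t := t) (m := v) (μ := μ)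
    ⟨hv, hh, he⟩
  refine ⟨n, rfl, ?_⟩
  simpa using (linearIndependent_string t hv hh he).fintype_card_le_finrank

lemma pow_string_eq_zero [Module.Finite ℂ U] (t : IsSl2Triple h e f) {v : U} {n : ℕ} (hv : v ≠ 0)
    (hh : h v = (n : ℂ) • v) (he : e v = 0) : (f ^ (n + 1)) v = 0 :=
  IsSl2Triple.HasPrimitiveVectorWith.pow_toEnd_f_eq_zero_of_eq_nat (t := t) (m := v)
    (μ := (n : ℂ)) ⟨hv, hh, he⟩ rfl

lemma e_pow_succ_string (t : IsSl2Triple h e f) {v : U} {μ : ℂ}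
    (hh : h v = μ • v) (he : e v = 0) (j : ℕ) :
    e ((f ^ (j + 1)) v) = ((j + 1) * (μ - j)) • (f ^ j) v :=
  lie_e_pow_succ (M := U) t hh he j

/-- An intertwiner from an irreducible representation to a representation with a highest weight
vector of the same weight. -/
lemma exists_intertwiner_end [Module.Finite ℂ U] [Module.Finite ℂ U'] (t : IsSl2Triple h e f) (t' : IsSl2Triple h' e' f') {n : ℕ}
    (hn : Module.finrank ℂ U = n + 1) {v : U} (hv : v ≠ 0) (hh : h v = (n : ℂ) • v)
    (he : e v = 0) {v' : U'} (hv' : v' ≠ 0) (hh' : h' v' = (n : ℂ) • v') (he' : e' v' = 0) :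
    ∃ P : U →ₗ[ℂ] U', Function.Injective P ∧ e' ∘ₗ P = P ∘ₗ e ∧ f' ∘ₗ P = P ∘ₗ f := by
  let b := basisOfLinearIndependentOfCardEqFinrank (linearIndependent_string t hv hh he)
    (by simp [hn])
  have hb : ∀ j, b j = (f ^ (j : ℕ)) v := fun j => by
    simp [b]
  let P := b.constr ℂ (fun j : Fin (n + 1) => (f' ^ (j : ℕ)) v')
  have hPb : ∀ j ≤ n, P ((f ^ j) v) = (f' ^ j) v' := fun j hj => by
    have := b.constr_basis ℂ (fun j : Fin (n + 1) => (f' ^ (j : ℕ)) v') ⟨j, by omega⟩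
    rwa [hb] at this
  refine ⟨P, ?_, b.ext fun j => ?_, b.ext fun j => ?_⟩
  · rw [injective_iff_map_eq_zero]
    intro x hx
    rw [Module.Basis.constr_apply_fintype] at hx
    have := Fintype.linearIndependent_iff.1 (linearIndependent_string t' hv' hh' he') _ hx
    rw [← b.sum_equivFun x]
    exact Finset.sum_eq_zero fun i _ => by rw [this i, zero_smul]
  · rw [hb, LinearMap.comp_apply, LinearMap.comp_apply, hPb _ (by omega)]
    obtain ⟨j, hj⟩ := j
    cases j with
    | zero => simp [he, he']
    | succ j =>
      simp only
      rw [e_pow_succ_string t hh he, e_pow_succ_string t' hh' he', map_smul, hPb _ (by omega)]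
  · rw [hb, LinearMap.comp_apply, LinearMap.comp_apply, hPb _ (by omega), ← Module.End.mul_apply,
      ← Module.End.mul_apply, ← pow_succ', ← pow_succ']
    rcases (Nat.lt_succ_iff.1 j.isLt).lt_or_eq with hj | hj
    · rw [hPb _ hj]
    · rw [hj, pow_string_eq_zero t hv hh he, pow_string_eq_zero t' hv' hh' he', map_zero]

end EndStrings

/-! ### Highest weight vectors and intertwiners for matrix triples -/

section MatrixStrings

variable {N : ℕ} {h e f : Matrix (Fin N) (Fin N) ℂ}

lemma isSl2Triple_toLin' (t : IsSl2Triple h e f) :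
    IsSl2Triple (Matrix.toLin' h) (Matrix.toLin' e) (Matrix.toLin' f) where
  h_ne_zero := by simpa using t.h_ne_zero
  lie_e_f := by
    rw [← t.lie_e_f, Ring.lie_def, Ring.lie_def, map_sub, Matrix.toLin'_mul, Matrix.toLin'_mul]
    rfl
  lie_h_e_nsmul := by
    rw [← map_nsmul, ← t.lie_h_e_nsmul, Ring.lie_def, Ring.lie_def, map_sub, Matrix.toLin'_mul,
      Matrix.toLin'_mul]
    rfl
  lie_h_f_nsmul := by
    rw [← map_nsmul, ← map_neg, ← t.lie_h_f_nsmul, Ring.lie_def, Ring.lie_def, map_sub,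
      Matrix.toLin'_mul, Matrix.toLin'_mul]
    rfl

lemma isSl2Triple_transpose (t : IsSl2Triple h e f) : IsSl2Triple hᵀ fᵀ eᵀ where
  h_ne_zero := by simpa using t.h_ne_zero
  lie_e_f := by
    rw [← t.lie_e_f, Ring.lie_def, Ring.lie_def, transpose_sub, transpose_mul, transpose_mul]
  lie_h_e_nsmul := by
    have := congrArg transpose t.lie_h_f_nsmul
    rw [Ring.lie_def, transpose_sub, transpose_mul, transpose_mul, transpose_neg,
      transpose_smul] at this
    rw [Ring.lie_def, ← neg_sub, this, neg_neg]
  lie_h_f_nsmul := by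
    have := congrArg transpose t.lie_h_e_nsmul
    rw [Ring.lie_def, transpose_sub, transpose_mul, transpose_mul, transpose_smul] at this
    rw [Ring.lie_def, ← neg_sub, this]

lemma isSl2Triple_val {K : LieSubalgebra ℂ (Matrix (Fin N) (Fin N) ℂ)} {h e f : K} (t : IsSl2Triple h e f) :
    IsSl2Triple h.1 e.1 f.1 where
  h_ne_zero := fun h0 => t.h_ne_zero (Subtype.ext h0)
  lie_e_f := congrArg Subtype.val t.lie_e_f
  lie_h_e_nsmul := congrArg Subtype.val t.lie_h_e_nsmul
  lie_h_f_nsmul := congrArg Subtype.val t.lie_h_f_nsmul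

/-- A triple whose nilpotent matrix is regular has a highest weight vector of maximal weight. -/
lemma exists_highest_of_pow_ne_zero (t : IsSl2Triple h e f) {s : ℕ}
    (hN : N = s + 1) (hs : e ^ s ≠ 0) :
    ∃ v : Fin N → ℂ, v ≠ 0 ∧ h *ᵥ v = (s : ℂ) • v ∧ e *ᵥ v = 0 := by
  have H : h * e - e * h = 2 • e := by
    have := t.lie_h_e_nsmul
    rwa [Ring.lie_def] at this
  have hpow : h * e ^ s = e ^ s * h + (2 * (s : ℂ)) • e ^ s :=
    sub_eq_iff_eq_add'.1 (lie_pow_of_lie_eq_two H s)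
  have he : e ^ (s + 1) = 0 := by
    rw [← hN]
    simpa using pow_card_eq_zero_of_isNilpotent (isNilpotent_of_commutator_eq H)
  obtain ⟨φ, u, hu⟩ := exists_dual_vectors he hs
  let ev : (Fin N → ℂ) →ₗ[ℂ] (Fin (s + 1) → ℂ) :=
    LinearMap.pi fun j => (dotProductBilin ℂ ℂ φ) ∘ₗ (e ^ (j : ℕ)).mulVecLin
  have hev : ∀ x j, ev x j = φ ⬝ᵥ (e ^ (j : ℕ) *ᵥ x) := fun x j => rfl
  have hz : ∀ j, s < j → e ^ j = 0 := fun j hj => pow_eq_zero_of_le hj he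
  -- Since `N = s + 1`, the numbers `φ (e ^ j x)` are coordinates of `x`; the duality of `φ` and `u`
  -- gives surjectivity.
  have hinj : Function.Injective ev := by
    rw [LinearMap.injective_iff_surjective_of_finrank_eq_finrank (by simp [hN])]
    intro c
    refine ⟨∑ j : Fin (s + 1), c j • (e ^ (s - (j : ℕ)) *ᵥ u), ?_⟩
    funext i
    rw [map_sum, Finset.sum_apply, Finset.sum_eq_single i]
    · rw [map_smul, Pi.smul_apply, hev, mulVec_mulVec, ← pow_add,
        show (i : ℕ) + (s - i) = s by omega, hu s le_rfl]
      simp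
    · intro j _ hj
      have hj' : (j : ℕ) ≠ i := fun h => hj (Fin.ext h)
      rw [map_smul, Pi.smul_apply, hev, mulVec_mulVec, ← pow_add]
      rcases lt_or_gt_of_ne hj' with hlt | hgt
      · rw [hz _ (by omega)]
        simp
      · rw [hu _ (by omega), if_neg (by omega)]
        simp
    · simp
  set v := e ^ s *ᵥ u with hv
  have hφv : φ ⬝ᵥ v = 1 := by rw [hv, hu s le_rfl, if_pos rfl]
  have hv0 : v ≠ 0 := fun h0 => by simp [h0] at hφv
  have hev0 : e *ᵥ v = 0 := by rw [hv, mulVec_mulVec, ← pow_succ', he, zero_mulVec]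
  have himg : ∀ x, e ^ s *ᵥ x = (φ ⬝ᵥ (e ^ s *ᵥ x)) • v := by
    intro x
    rw [← sub_eq_zero]
    apply hinj
    rw [map_zero]
    funext j
    rw [hev, Pi.zero_apply]
    by_cases hj : (j : ℕ) = 0
    · rw [hj, pow_zero, one_mulVec, dotProduct_sub, dotProduct_smul, hφv]
      simp
    · rw [hv, mulVec_sub, mulVec_smul, mulVec_mulVec, mulVec_mulVec, ← pow_add, hz _ (by omega)]
      simp
  set lam : ℂ := φ ⬝ᵥ (e ^ s *ᵥ (h *ᵥ u)) + 2 * s with hlam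
  have hhv : h *ᵥ v = lam • v := by
    rw [hv, mulVec_mulVec, hpow, add_mulVec, ← mulVec_mulVec, himg, smul_mulVec, ← hv,
      ← add_smul]
  -- The image of `e ^ s` is the line of `v`. The dual line, spanned by `w`, gives a highest weight
  -- vector for the transposed triple, of weight `2s - lam`. Both weights are naturals at most `s`
  -- by dimension and add up to `2s`, so both equal `s`.
  set w := (e ^ s)ᵀ *ᵥ φ with hw
  have hwx : ∀ x, w ⬝ᵥ x = φ ⬝ᵥ (e ^ s *ᵥ x) := by
    intro x
    rw [hw, mulVec_transpose, dotProduct_mulVec]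
  have hw0 : w ≠ 0 := fun h0 => by
    have := hwx u
    rw [h0, ← hv, hφv] at this
    simp at this
  have hew : eᵀ *ᵥ w = 0 := by
    rw [hw, mulVec_mulVec, ← transpose_mul, ← pow_succ, he]
    simp
  have hhw : hᵀ *ᵥ w = (lam - 2 * s) • w := by
    refine dotProduct_eq _ _ fun x => ?_
    have h1 : e ^ s * h = h * e ^ s - (2 * (s : ℂ)) • e ^ s := by
      rw [hpow]; abel
    rw [mulVec_transpose, ← dotProduct_mulVec, hwx, mulVec_mulVec, h1, sub_mulVec, ← mulVec_mulVec,
      himg x, mulVec_smul, hhv, smul_mulVec, himg x, smul_dotProduct, hwx]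
    simp only [dotProduct_sub, dotProduct_smul, hφv, smul_eq_mul]
    ring
  have hfin : Module.finrank ℂ (Fin N → ℂ) = s + 1 := by simp [hN]
  obtain ⟨n₁, h1, h1'⟩ := exists_nat_weight (isSl2Triple_toLin' t) hv0 (μ := lam)
    (by simpa using hhv) (by simpa using hev0)
  obtain ⟨n₂, h2, h2'⟩ := exists_nat_weight (isSl2Triple_toLin' (isSl2Triple_transpose t)).symm hw0
    (μ := 2 * s - lam) (by
      rw [LinearMap.neg_apply, toLin'_apply, hhw]; module) (by simpa using hew)
  have h3 : n₁ + n₂ = 2 * s := by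
    have : (n₁ : ℂ) + n₂ = 2 * s := by rw [← h1, ← h2]; ring
    exact_mod_cast this
  refine ⟨v, hv0, ?_, hev0⟩
  rw [hhv, h1, show n₁ = s by omega]

lemma exists_intertwiner {M : ℕ} {h' e' f' : Matrix (Fin M) (Fin M) ℂ} (t : IsSl2Triple h e f)
    (t' : IsSl2Triple h' e' f') {s : ℕ} (hN : N = s + 1)
    {v : Fin N → ℂ} (hv : v ≠ 0) (hh : h *ᵥ v = (s : ℂ) • v) (he : e *ᵥ v = 0)
    {v' : Fin M → ℂ} (hv' : v' ≠ 0) (hh' : h' *ᵥ v' = (s : ℂ) • v') (he' : e' *ᵥ v' = 0) :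
    ∃ P : Matrix (Fin M) (Fin N) ℂ, Function.Injective P.mulVec ∧ e' * P = P * e ∧ f' * P = P * f := by
  obtain ⟨P, hP, hPe, hPf⟩ := exists_intertwiner_end (isSl2Triple_toLin' t)
    (isSl2Triple_toLin' t') (n := s) (by simp [hN]) hv (by simpa using hh) (by simpa using he)
    hv' (by simpa using hh') (by simpa using he')
  have hP' : ∀ x, LinearMap.toMatrix' P *ᵥ x = P x := fun x => by
    rw [← toLin'_apply, toLin'_toMatrix']
  refine ⟨LinearMap.toMatrix' P, fun x y hxy => hP ?_, ?_, ?_⟩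
  · simpa only [hP'] using hxy
  · have := congrArg LinearMap.toMatrix' hPe
    simpa only [LinearMap.toMatrix'_comp, LinearMap.toMatrix'_toLin'] using this
  · have := congrArg LinearMap.toMatrix' hPf
    simpa only [LinearMap.toMatrix'_comp, LinearMap.toMatrix'_toLin'] using this

end MatrixStrings

end Representations

/-! ### The principal nilpotent element of type D -/

section TypeD

open Matrix

variable {n : ℕ}

lemma dFMatrix_mulVec_of_lt (x : Fin (2 * n) → ℂ) {i j : ℕ} (hij : i = j + 1) (hi : i < n) :
    (dFMatrix n *ᵥ x) ⟨i, by omega⟩ = x ⟨j, by omega⟩ := by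
  rw [mulVec, dotProduct, Finset.sum_eq_single ⟨j, by omega⟩]
  · simp [dFMatrix, hij, show j + 1 < n by omega]
  · rintro ⟨k, hk⟩ _ hne
    simp only [ne_eq, Fin.mk.injEq] at hne
    simp only [dFMatrix, of_apply]
    split_ifs <;> first | (exfalso; omega) | simp
  · simp

lemma dFMatrix_mulVec_mid (hn : 2 ≤ n) (x : Fin (2 * n) → ℂ) :
    (dFMatrix n *ᵥ x) ⟨n, by omega⟩ = x ⟨n - 2, by omega⟩ := by
  rw [mulVec, dotProduct, Finset.sum_eq_single ⟨n - 2, by omega⟩]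
  · simp [dFMatrix, hn]
  · rintro ⟨k, hk⟩ _ hne
    simp only [ne_eq, Fin.mk.injEq] at hne
    simp only [dFMatrix, of_apply]
    split_ifs <;> first | (exfalso; omega) | simp
  · simp

lemma dFMatrix_mulVec_succ (hn : 2 ≤ n) (x : Fin (2 * n) → ℂ) :
    (dFMatrix n *ᵥ x) ⟨n + 1, by omega⟩ = -(x ⟨n - 1, by omega⟩ + x ⟨n, by omega⟩) := by
  rw [mulVec, dotProduct, Fintype.sum_eq_add ⟨n - 1, by omega⟩ ⟨n, by omega⟩]
  · have h1 : n - 1 + 1 = n := by omega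
    simp [dFMatrix, h1]
    ring
  · simp only [ne_eq, Fin.mk.injEq]
    omega
  · rintro ⟨k, hk⟩ ⟨h1, h2⟩
    simp only [ne_eq, Fin.mk.injEq] at h1 h2
    simp only [dFMatrix, of_apply]
    split_ifs <;> first | (exfalso; omega) | simp

lemma dFMatrix_mulVec_of_gt (x : Fin (2 * n) → ℂ) {i j : ℕ} (hij : i = j + 1) (hj : n < j)
    (hi : i < 2 * n) : (dFMatrix n *ᵥ x) ⟨i, hi⟩ = -x ⟨j, by omega⟩ := by
  rw [mulVec, dotProduct, Finset.sum_eq_single ⟨j, by omega⟩]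
  · simp only [dFMatrix, of_apply]
    rw [if_neg (by omega), if_neg (by omega), if_neg (by omega), if_pos (by omega)]
    simp
  · rintro ⟨k, hk⟩ _ hne
    simp only [ne_eq, Fin.mk.injEq] at hne
    simp only [dFMatrix, of_apply]
    split_ifs <;> first | (exfalso; omega) | simp
  · simp

/-- The vector in the kernel of the principal nilpotent that is not in its image. -/
noncomputable def dKerVec (hn : 2 ≤ n) : Fin (2 * n) → ℂ :=
  Pi.single ⟨n - 1, by omega⟩ 1 - Pi.single ⟨n, by omega⟩ 1

/-- The last standard basis vector. -/
noncomputable def dLastVec (hn : 2 ≤ n) : Fin (2 * n) → ℂ := Pi.single ⟨2 * n - 1, by omega⟩ 1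

/-- The first standard basis vector. -/
noncomputable def dFirstVec (hn : 2 ≤ n) : Fin (2 * n) → ℂ := Pi.single ⟨0, by omega⟩ 1

lemma dKerVec_dotProduct (hn : 2 ≤ n) (x : Fin (2 * n) → ℂ) :
    dKerVec hn ⬝ᵥ x = x ⟨n - 1, by omega⟩ - x ⟨n, by omega⟩ := by
  simp [dKerVec, sub_dotProduct]

lemma dFMatrix_mulVec_dKerVec (hn : 2 ≤ n) : dFMatrix n *ᵥ dKerVec hn = 0 := by
  rw [dKerVec, mulVec_sub, mulVec_single_one, mulVec_single_one]
  funext i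
  simp only [Pi.sub_apply, col_apply, dFMatrix, of_apply, Pi.zero_apply]
  split_ifs <;> first | (exfalso; omega) | simp

lemma dFMatrix_mulVec_dLastVec (hn : 2 ≤ n) : dFMatrix n *ᵥ dLastVec hn = 0 := by
  rw [dLastVec, mulVec_single_one]
  funext i
  have := i.isLt
  simp only [col_apply, dFMatrix, of_apply, Pi.zero_apply]
  split_ifs <;> first | (exfalso; omega) | simp

lemma exists_dFMatrix_mulVec_eq_dLastVec (hn : 2 ≤ n) : ∃ y, dFMatrix n *ᵥ y = dLastVec hn := by
  refine ⟨-Pi.single ⟨2 * n - 2, by omega⟩ 1, ?_⟩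
  rw [mulVec_neg, dLastVec, mulVec_single_one]
  funext i
  have := i.isLt
  simp only [Pi.neg_apply, col_apply, dFMatrix, of_apply, Pi.single_apply, Fin.ext_iff]
  split_ifs <;> first | (exfalso; omega) | simp

/-- The two middle rows of the nilpotent matrix coincide. -/
lemma dKerVec_dotProduct_dFMatrix_mulVec (hn : 2 ≤ n) (x : Fin (2 * n) → ℂ) :
    dKerVec hn ⬝ᵥ (dFMatrix n *ᵥ x) = 0 := by
  rw [dKerVec_dotProduct, dFMatrix_mulVec_of_lt x (j := n - 2) (by omega) (by omega),
    dFMatrix_mulVec_mid hn, sub_self]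

lemma eq_of_dFMatrix_mulVec_eq_zero (hn : 2 ≤ n) {x : Fin (2 * n) → ℂ}
    (hx : dFMatrix n *ᵥ x = 0) :
    x = x ⟨n - 1, by omega⟩ • dKerVec hn + x ⟨2 * n - 1, by omega⟩ • dLastVec hn := by
  have hmid : x ⟨n, by omega⟩ = -x ⟨n - 1, by omega⟩ := by
    have := dFMatrix_mulVec_succ hn x
    rw [hx, Pi.zero_apply] at this
    linear_combination this
  funext ⟨i, hi⟩
  simp only [dKerVec, dLastVec, Pi.add_apply, Pi.smul_apply, Pi.sub_apply, Pi.single_apply,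
    Fin.mk.injEq, smul_eq_mul]
  rcases lt_trichotomy i (n - 1) with h | h | h
  · have := dFMatrix_mulVec_of_lt x (i := i + 1) (j := i) rfl (by omega)
    rw [hx, Pi.zero_apply] at this
    rw [if_neg (by omega), if_neg (by omega), if_neg (by omega), ← this]
    simp
  · subst h
    rw [if_pos rfl, if_neg (by omega), if_neg (by omega)]
    simp
  · rcases Nat.eq_or_lt_of_le (show n ≤ i by omega) with h2 | h2
    · subst h2
      rw [if_neg (by omega), if_pos rfl, if_neg (by omega), hmid]
      simp
    · rcases Nat.eq_or_lt_of_le (show i ≤ 2 * n - 1 by omega) with h3 | h3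
      · subst h3
        rw [if_neg (by omega), if_neg (by omega), if_pos rfl]
        simp
      · have := dFMatrix_mulVec_of_gt x (i := i + 1) (j := i) rfl (by omega) (by omega)
        rw [hx, Pi.zero_apply] at this
        rw [if_neg (by omega), if_neg (by omega), if_neg (by omega)]
        linear_combination this

/-- The grading of the standard basis vectors for which the principal nilpotent has degree one. -/
def dHeight (n i : ℕ) : ℕ := if i < n then i else i - 1

lemma dHeight_of_dFMatrix_pow_ne_zero (hn : 2 ≤ n) (k : ℕ) {i j : Fin (2 * n)}
    (h : (dFMatrix n ^ k) i j ≠ 0) : dHeight n i = dHeight n j + k := by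
  induction k generalizing i with
  | zero =>
    rw [pow_zero, one_apply] at h
    have : i = j := by by_contra hne; exact h (if_neg hne)
    rw [this, add_zero]
  | succ k ih =>
    rw [pow_succ', mul_apply] at h
    obtain ⟨l, -, hl⟩ := Finset.exists_ne_zero_of_sum_ne_zero h
    have h1 := ih (right_ne_zero_of_mul hl)
    have h2 : dHeight n i = dHeight n l + 1 := by
      have h3 := left_ne_zero_of_mul hl
      simp only [dFMatrix, of_apply] at h3
      unfold dHeight
      split_ifs at h3 ⊢ <;> first | omega | exact absurd rfl h3
    omega

/-- The first basis vector descends to the middle, splits into two equal parts there, and these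
recombine with the same sign to `-2`; afterwards only signs change. -/
lemma dFMatrix_pow_corner_ne_zero (hn : 2 ≤ n) :
    (dFMatrix n ^ (2 * n - 2)) ⟨2 * n - 1, by omega⟩ ⟨0, by omega⟩ ≠ 0 := by
  have hstep : ∀ k i, (dFMatrix n ^ (k + 1)) i ⟨0, by omega⟩ =
      (dFMatrix n *ᵥ fun l => (dFMatrix n ^ k) l ⟨0, by omega⟩) i := by
    intro k i
    rw [pow_succ', mul_apply]
    rfl
  have h1 : ∀ k (hk : k < n), (dFMatrix n ^ k) ⟨k, by omega⟩ ⟨0, by omega⟩ = 1 := by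
    intro k
    induction k with
    | zero => intro _; simp
    | succ k ih =>
      intro hk
      rw [hstep, dFMatrix_mulVec_of_lt _ (j := k) rfl hk, ih (by omega)]
  have h2 : (dFMatrix n ^ (n - 1)) ⟨n, by omega⟩ ⟨0, by omega⟩ = 1 := by
    have := hstep (n - 2) ⟨n, by omega⟩
    rw [show n - 2 + 1 = n - 1 by omega] at this
    rw [this, dFMatrix_mulVec_mid hn, h1 _ (by omega)]
  have h3 : (dFMatrix n ^ n) ⟨n + 1, by omega⟩ ⟨0, by omega⟩ = -2 := by
    have := hstep (n - 1) ⟨n + 1, by omega⟩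
    rw [show n - 1 + 1 = n by omega] at this
    rw [this, dFMatrix_mulVec_succ hn, h1 _ (by omega), h2]
    norm_num
  have h4 : ∀ k (hk : n + 1 + k < 2 * n),
      (dFMatrix n ^ (n + k)) ⟨n + 1 + k, hk⟩ ⟨0, by omega⟩ ≠ 0 := by
    intro k
    induction k with
    | zero =>
      intro hk
      simp [h3]
    | succ k ih =>
      intro hk
      rw [← add_assoc, hstep,
        dFMatrix_mulVec_of_gt _ (i := n + 1 + (k + 1)) (j := n + 1 + k) rfl (by omega) hk]
      exact neg_ne_zero.2 (ih (by omega))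
  have := h4 (n - 2) (by omega)
  simpa only [show n + (n - 2) = 2 * n - 2 by omega, show n + 1 + (n - 2) = 2 * n - 1 by omega]
    using this

lemma dSMatrix_eq (hn : 2 ≤ n) : dSMatrix n =
    vecMulVec (dKerVec hn) (dFirstVec hn) + vecMulVec (dLastVec hn) (dKerVec hn) := by
  ext ⟨i, hi⟩ ⟨j, hj⟩
  simp only [dSMatrix, of_apply, dKerVec, dFirstVec, dLastVec, Matrix.add_apply, vecMulVec_apply,
    Pi.sub_apply, Pi.single_apply, Fin.mk.injEq]
  split_ifs <;> first | (exfalso; omega) | simp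

lemma antidiagForm_mulVec {N : ℕ} (x : Fin N → ℂ) (i : Fin N) :
    (antidiagForm N *ᵥ x) i = x (Fin.rev i) := by
  simp [antidiagForm, mulVec, dotProduct]

lemma antidiagForm_transpose (N : ℕ) : (antidiagForm N)ᵀ = antidiagForm N := by
  ext i j
  simp only [antidiagForm, transpose_apply, of_apply, Fin.ext_iff, Fin.val_rev]
  have := i.isLt
  have := j.isLt
  split_ifs <;> first | rfl | (exfalso; omega)

lemma antidiagForm_mulVec_dKerVec (hn : 2 ≤ n) :
    antidiagForm (2 * n) *ᵥ dKerVec hn = -dKerVec hn := by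
  funext ⟨i, hi⟩
  simp only [antidiagForm_mulVec, dKerVec, Pi.neg_apply, Pi.sub_apply, Pi.single_apply,
    Fin.ext_iff, Fin.val_rev]
  split_ifs <;> first | (exfalso; omega) | simp

lemma antidiagForm_mulVec_dLastVec (hn : 2 ≤ n) :
    antidiagForm (2 * n) *ᵥ dLastVec hn = dFirstVec hn := by
  funext ⟨i, hi⟩
  simp only [antidiagForm_mulVec, dLastVec, dFirstVec, Pi.single_apply, Fin.ext_iff, Fin.val_rev]
  split_ifs <;> first | (exfalso; omega) | simp

lemma soD_transpose_mul (X : soD n) :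
    X.1ᵀ * antidiagForm (2 * n) = -(antidiagForm (2 * n) * X.1) := by
  have : X.1ᵀ * antidiagForm (2 * n) = antidiagForm (2 * n) * (-X.1) :=
    (mem_skewAdjointMatricesSubmodule (J := antidiagForm (2 * n)) (A₁ := X.1)).mp X.2
  rw [this, mul_neg]

lemma vecMul_antidiagForm (X : soD n) (x : Fin (2 * n) → ℂ) :
    (antidiagForm (2 * n) *ᵥ x) ᵥ* X.1 = -(antidiagForm (2 * n) *ᵥ (X.1 *ᵥ x)) := by
  rw [← mulVec_transpose, mulVec_mulVec, soD_transpose_mul, neg_mulVec, mulVec_mulVec]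

/-- The kernel equation makes the middle coordinates opposite and orthogonality makes them equal, so
both vanish. -/
lemma eq_smul_dLastVec (hn : 2 ≤ n) {y : Fin (2 * n) → ℂ} (hy : dFMatrix n *ᵥ y = 0)
    (horth : dKerVec hn ⬝ᵥ y = 0) : y = y ⟨2 * n - 1, by omega⟩ • dLastVec hn := by
  have h0 : y ⟨n - 1, by omega⟩ = 0 := by
    have := dFMatrix_mulVec_succ hn y
    rw [hy, Pi.zero_apply] at this
    rw [dKerVec_dotProduct] at horth
    linear_combination (horth + this) / 2
  have heq := eq_of_dFMatrix_mulVec_eq_zero hn hy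
  rwa [h0, zero_smul, zero_add] at heq

lemma dFMatrix_mul_weight {H E : soD n} (t : IsSl2Triple H E (dF n)) :
    dFMatrix n * H.1 = H.1 * dFMatrix n + (2 : ℂ) • dFMatrix n := by
  have h2 : H.1 * dFMatrix n - dFMatrix n * H.1 = -((2 : ℕ) • dFMatrix n) :=
    congrArg Subtype.val t.lie_h_f_nsmul
  rw [← Nat.cast_smul_eq_nsmul ℂ] at h2
  rw [sub_eq_iff_eq_add.1 h2]
  push_cast
  abel

/-- The weight of the last basis vector. -/
lemma mulVec_dLastVec (hn : 2 ≤ n) {H E : soD n} (t : IsSl2Triple H E (dF n)) :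
    H.1 *ᵥ dLastVec hn = -((2 * n - 2 : ℕ) : ℂ) • dLastVec hn := by
  have hFH := dFMatrix_mul_weight t
  have hHF : H.1 * dFMatrix n = dFMatrix n * H.1 - (2 : ℂ) • dFMatrix n := by rw [hFH]; abel
  have hker : dFMatrix n *ᵥ (H.1 *ᵥ dLastVec hn) = 0 := by
    rw [mulVec_mulVec, hFH, add_mulVec, ← mulVec_mulVec, smul_mulVec, dFMatrix_mulVec_dLastVec]
    simp
  -- `H` preserves the image of the nilpotent as well as its kernel, and `dKerVec` is orthogonal to
  -- that image.
  have horth : dKerVec hn ⬝ᵥ (H.1 *ᵥ dLastVec hn) = 0 := by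
    obtain ⟨y, hy⟩ := exists_dFMatrix_mulVec_eq_dLastVec hn
    rw [← hy, mulVec_mulVec, hHF, sub_mulVec, ← mulVec_mulVec, smul_mulVec, dotProduct_sub,
      dotProduct_smul, dKerVec_dotProduct_dFMatrix_mulVec, dKerVec_dotProduct_dFMatrix_mulVec]
    simp
  have heq := eq_smul_dLastVec hn hker horth
  set y := H.1 *ᵥ dLastVec hn with hy
  have hcorner : y ⟨2 * n - 1, by omega⟩ = H.1 ⟨2 * n - 1, by omega⟩ ⟨2 * n - 1, by omega⟩ := by
    rw [hy, dLastVec, mulVec_single_one, col_apply]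
  rw [heq, hcorner]
  congr 1
  set β := H.1 ⟨2 * n - 1, by omega⟩ ⟨2 * n - 1, by omega⟩ with hβ
  have hskew : H.1 ⟨0, by omega⟩ ⟨0, by omega⟩ = -β := by
    have := congrFun (congrFun (soD_transpose_mul H) ⟨0, by omega⟩) ⟨2 * n - 1, by omega⟩
    have r1 : Fin.rev (⟨0, by omega⟩ : Fin (2 * n)) = ⟨2 * n - 1, by omega⟩ := by
      ext; simp
    have r2 : ∀ x : Fin (2 * n), (⟨2 * n - 1, by omega⟩ : Fin (2 * n)) = Fin.rev x ↔
        x = ⟨0, by omega⟩ := fun x => by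
      simp only [Fin.ext_iff, Fin.val_rev]
      have := x.isLt
      omega
    simpa [mul_apply, antidiagForm, r1, r2] using this
  have hpow : ∀ k : ℕ, H.1 * dFMatrix n ^ k =
      dFMatrix n ^ k * H.1 - (2 * (k : ℂ)) • dFMatrix n ^ k := by
    intro k
    have ht := lie_pow_of_lie_eq_two (h := -H.1) (e := dFMatrix n) (by
      rw [neg_mul, mul_neg, hHF, ← Nat.cast_smul_eq_nsmul ℂ]
      push_cast
      abel) k
    rw [neg_mul, mul_neg] at ht
    rw [← ht]
    abel
  -- In the corner entry, heights leave only diagonal entries of `H`, namely `β` and, by skewness,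
  -- `-β`. The relation becomes `β c = -β c - 2(2n - 2) c`.
  have hent := congrFun (congrFun (hpow (2 * n - 2)) ⟨2 * n - 1, by omega⟩) ⟨0, by omega⟩
  have hc := dFMatrix_pow_corner_ne_zero hn
  set c := (dFMatrix n ^ (2 * n - 2)) ⟨2 * n - 1, by omega⟩ ⟨0, by omega⟩ with hcdef
  have e1 : (H.1 * dFMatrix n ^ (2 * n - 2)) ⟨2 * n - 1, by omega⟩ ⟨0, by omega⟩ = β * c := by
    rw [mul_apply, Finset.sum_eq_single ⟨2 * n - 1, by omega⟩]
    · rintro k _ hk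
      by_contra hne
      have := dHeight_of_dFMatrix_pow_ne_zero hn _ (right_ne_zero_of_mul hne)
      simp only [dHeight] at this
      have hk' := k.isLt
      simp only [ne_eq, Fin.ext_iff] at hk
      split_ifs at this <;> omega
    · simp
  have e2 : (dFMatrix n ^ (2 * n - 2) * H.1) ⟨2 * n - 1, by omega⟩ ⟨0, by omega⟩ = c * (-β) := by
    rw [mul_apply, Finset.sum_eq_single ⟨0, by omega⟩]
    · rw [hskew]
    · rintro k _ hk
      by_contra hne
      have := dHeight_of_dFMatrix_pow_ne_zero hn _ (left_ne_zero_of_mul hne)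
      simp only [dHeight] at this
      have hk' := k.isLt
      simp only [ne_eq, Fin.ext_iff] at hk
      split_ifs at this <;> omega
    · simp
  rw [e1, Matrix.sub_apply, e2, Matrix.smul_apply, smul_eq_mul] at hent
  refine mul_right_cancel₀ hc ?_
  linear_combination hent / 2

end TypeD

/-! ### The invariant line and its reflection -/

section TypeDReflection

open Matrix

variable {n : ℕ}

/-- The line fixed by the triple: a vector of the kernel of the principal nilpotent element that is
annihilated by the whole triple, and whose reflection commutes with the triple. -/
lemma exists_invariant_vector (hn : 2 ≤ n) {H E : soD n} (t : IsSl2Triple H E (dF n)) :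
    ∃ c : ℂ, H.1 *ᵥ (dKerVec hn + c • dLastVec hn) = 0 ∧
      E.1 *ᵥ (dKerVec hn + c • dLastVec hn) = 0 ∧
      dFMatrix n *ᵥ (dKerVec hn + c • dLastVec hn) = 0 := by
  have hlast := mulVec_dLastVec hn t
  set s : ℂ := ((2 * n - 2 : ℕ) : ℂ) with hs
  have hs0 : s ≠ 0 := Nat.cast_ne_zero.2 (by omega)
  have hFH := dFMatrix_mul_weight t
  have hker : dFMatrix n *ᵥ (H.1 *ᵥ dKerVec hn) = 0 := by
    rw [mulVec_mulVec, hFH, add_mulVec, ← mulVec_mulVec, smul_mulVec, dFMatrix_mulVec_dKerVec]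
    simp
  set y := H.1 *ᵥ dKerVec hn with hy
  -- `dKerVec` is an eigenvector of the form, so this product is up to sign the form of a vector
  -- with its image under a skew-adjoint `H`, which is zero.
  have horth : dKerVec hn ⬝ᵥ y = 0 := by
    have h1 := congrArg (fun x => x ⬝ᵥ dKerVec hn) (vecMul_antidiagForm H (dKerVec hn))
    simp only [antidiagForm_mulVec_dKerVec, neg_vecMul, neg_dotProduct, ← dotProduct_mulVec] at h1
    have h2 : (antidiagForm (2 * n) *ᵥ y) ⬝ᵥ dKerVec hn = -(dKerVec hn ⬝ᵥ y) := by
      rw [dotProduct_comm, dotProduct_mulVec, ← mulVec_transpose, antidiagForm_transpose,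
        antidiagForm_mulVec_dKerVec, neg_dotProduct]
    rw [← hy, h2] at h1
    linear_combination -h1 / 2
  have heq := eq_smul_dLastVec hn hker horth
  set β := y ⟨2 * n - 1, by omega⟩ with hβ
  -- `H` sends `dKerVec` to `β • dLastVec`, and `dLastVec` has weight `-s`; the coefficient `β / s`
  -- cancels the two.
  have hH : H.1 *ᵥ (dKerVec hn + (β / s) • dLastVec hn) = 0 := by
    rw [mulVec_add, mulVec_smul, hlast, ← hy, heq, smul_smul, ← add_smul]
    rw [show β + β / s * -s = 0 by field_simp; ring, zero_smul]
  have hF : dFMatrix n *ᵥ (dKerVec hn + (β / s) • dLastVec hn) = 0 := by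
    rw [mulVec_add, mulVec_smul, dFMatrix_mulVec_dKerVec, dFMatrix_mulVec_dLastVec]
    simp
  have hne : dKerVec hn + (β / s) • dLastVec hn ≠ 0 := by
    intro h
    have := congrFun h ⟨n, by omega⟩
    have e1 : (⟨n, by omega⟩ : Fin (2 * n)) ≠ ⟨n - 1, by omega⟩ := by
      simp only [ne_eq, Fin.mk.injEq]; omega
    have e3 : (⟨n, by omega⟩ : Fin (2 * n)) ≠ ⟨2 * n - 1, by omega⟩ := by
      simp only [ne_eq, Fin.mk.injEq]; omega
    simp [dKerVec, dLastVec, e1, e3] at this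
  refine ⟨β / s, hH, ?_, hF⟩
  -- For the opposite triple the vector is primitive of weight `0`, so its string has length one and
  -- `E` kills it.
  have := pow_string_eq_zero (isSl2Triple_toLin' (isSl2Triple_val t)).symm (n := 0) hne
    (by rw [LinearMap.neg_apply, toLin'_apply, hH]; simp)
    (by rw [toLin'_apply]; exact hF)
  simpa using this

/-- A reflection that commutes with the triple and anticommutes with `S`, together with the weight
of `S`. -/
theorem exists_reflection (hn : 2 ≤ n) {H E : soD n} (t : IsSl2Triple H E (dF n)) :
    ∃ R : Matrix (Fin (2 * n)) (Fin (2 * n)) ℂ, R * R = 1 ∧ E.1 * R = R * E.1 ∧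
      dFMatrix n * R = R * dFMatrix n ∧ dSMatrix n * R = R * (-dSMatrix n) ∧
      ⁅H, dS hn⁆ = -((2 * n - 2 : ℕ) : ℂ) • dS hn ∧ ⁅dF n, dS hn⁆ = 0 := by
  obtain ⟨c, hH, hE, hF⟩ := exists_invariant_vector hn t
  have hlast := mulVec_dLastVec hn t
  set a := dKerVec hn + c • dLastVec hn with ha
  set b := antidiagForm (2 * n) *ᵥ a with hb
  have hb' : b = -dKerVec hn + c • dFirstVec hn := by
    rw [hb, ha, mulVec_add, mulVec_smul, antidiagForm_mulVec_dKerVec, antidiagForm_mulVec_dLastVec]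
  have e1 : (⟨n, by omega⟩ : Fin (2 * n)) ≠ ⟨n - 1, by omega⟩ := by
    simp only [ne_eq, Fin.mk.injEq]; omega
  have e2 : (⟨n - 1, by omega⟩ : Fin (2 * n)) ≠ ⟨2 * n - 1, by omega⟩ := by
    simp only [ne_eq, Fin.mk.injEq]; omega
  have e3 : (⟨n, by omega⟩ : Fin (2 * n)) ≠ ⟨2 * n - 1, by omega⟩ := by
    simp only [ne_eq, Fin.mk.injEq]; omega
  have e4 : (⟨0, by omega⟩ : Fin (2 * n)) ≠ ⟨n - 1, by omega⟩ := by
    simp only [ne_eq, Fin.mk.injEq]; omega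
  have e5 : (⟨0, by omega⟩ : Fin (2 * n)) ≠ ⟨n, by omega⟩ := by
    simp only [ne_eq, Fin.mk.injEq]; omega
  have e6 : (⟨0, by omega⟩ : Fin (2 * n)) ≠ ⟨2 * n - 1, by omega⟩ := by
    simp only [ne_eq, Fin.mk.injEq]; omega
  have huu : dKerVec hn ⬝ᵥ dKerVec hn = 2 := by
    rw [dKerVec_dotProduct]
    simp [dKerVec, e1, e1.symm]
    norm_num
  have hul : dKerVec hn ⬝ᵥ dLastVec hn = 0 := by
    rw [dKerVec_dotProduct]
    simp [dLastVec, e2, e3]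
  have hfu : dFirstVec hn ⬝ᵥ dKerVec hn = 0 := by
    simp [dFirstVec, dKerVec, e4, e5]
  have hfl : dFirstVec hn ⬝ᵥ dLastVec hn = 0 := by
    simp [dFirstVec, dLastVec, e6]
  have hba : b ⬝ᵥ a = -2 := by
    rw [hb', ha]
    simp only [add_dotProduct, dotProduct_add, neg_dotProduct, smul_dotProduct, dotProduct_smul,
      huu, hul, hfu, hfl, smul_eq_mul]
    ring
  have hbl : b ⬝ᵥ dLastVec hn = 0 := by
    rw [hb']
    simp [add_dotProduct, smul_dotProduct, hul, hfl]
  have hfa : dFirstVec hn ⬝ᵥ a = 0 := by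
    rw [ha]
    simp [dotProduct_add, dotProduct_smul, hfu, hfl]
  -- Replacing `dKerVec` by `a` and `-b` introduces two terms in `c`, which cancel.
  have hS : dSMatrix n = vecMulVec a (dFirstVec hn) - vecMulVec (dLastVec hn) b := by
    rw [dSMatrix_eq hn, hb', ha]
    simp only [add_vecMulVec, vecMulVec_add, vecMulVec_neg, smul_vecMulVec,
      vecMulVec_smul]
    module
  have hb0 : ∀ X : soD n, X.1 *ᵥ a = 0 → b ᵥ* X.1 = 0 := fun X hX => by
    rw [hb, vecMul_antidiagForm, hX]
    simp
  have hcomm : ∀ X : soD n, X.1 *ᵥ a = 0 →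
      X.1 * (1 + vecMulVec a b) = (1 + vecMulVec a b) * X.1 := fun X hX => by
    rw [mul_add, add_mul, mul_vecMulVec, vecMulVec_mul, hX, hb0 X hX]
    simp
  have hlH : dFirstVec hn ᵥ* H.1 = ((2 * n - 2 : ℕ) : ℂ) • dFirstVec hn := by
    rw [← antidiagForm_mulVec_dLastVec, vecMul_antidiagForm, hlast, mulVec_smul]
    simp
  have hlF : dFirstVec hn ᵥ* dFMatrix n = 0 := by
    have := vecMul_antidiagForm (dF n) (dLastVec hn)
    rw [antidiagForm_mulVec_dLastVec] at this
    refine this.trans ?_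
    rw [show (dF n).1 = dFMatrix n from rfl, dFMatrix_mulVec_dLastVec]
    simp
  -- As `b ⬝ᵥ a = -2`, this is the orthogonal reflection in `a` for the form.
  refine ⟨1 + vecMulVec a b, ?_, hcomm E hE, hcomm (dF n) hF, ?_, Subtype.ext ?_, Subtype.ext ?_⟩
  · simp only [mul_add, add_mul, vecMulVec_mul_vecMulVec, hba, mul_one, one_mul, vecMulVec_smul]
    module
  · rw [hS]
    simp only [mul_add, add_mul, sub_mul, mul_sub, mul_neg, vecMulVec_mul_vecMulVec, hfa, hbl, hba,
      one_mul, mul_one, vecMulVec_smul]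
    simp
    module
  · change H.1 * dSMatrix n - dSMatrix n * H.1 = -((2 * n - 2 : ℕ) : ℂ) • dSMatrix n
    rw [hS, mul_sub, sub_mul, mul_vecMulVec, mul_vecMulVec, vecMulVec_mul, vecMulVec_mul, hH,
      hb0 H hH, hlH, hlast]
    simp only [vecMulVec_smul, smul_vecMulVec, zero_vecMulVec, vecMulVec_zero]
    module
  · change dFMatrix n * dSMatrix n - dSMatrix n * dFMatrix n = 0
    rw [hS, mul_sub, sub_mul, mul_vecMulVec, mul_vecMulVec, vecMulVec_mul, vecMulVec_mul, hF,
      show b ᵥ* dFMatrix n = 0 from hb0 (dF n) hF, hlF, dFMatrix_mulVec_dLastVec]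
    simp

end TypeDReflection

/-! ### Natural bases of the classical Lie algebras -/

section NaturalBases

open Matrix

/-- The strings are independent already, so an upper bound for the dimension suffices for spanning.
-/
lemma isNaturalBasis_of_finrank_le {L : Type*} [LieRing L] [LieAlgebra ℂ L] [Module.Finite ℂ L]
    {ι : Type*} [Fintype ι] {h e f : L} {d : ι → ℕ} {v : ι → L} (t : IsSl2Triple h e f)
    (hv : LinearIndependent ℂ v) (he : ∀ i, ⁅e, v i⁆ = 0)
    (hh : ∀ i, ⁅h, v i⁆ = (2 * (d i : ℂ)) • v i)
    (hdim : Module.finrank ℂ L ≤ ∑ i, (2 * d i + 1)) : IsNaturalBasis h e f d v := by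
  have hli : LinearIndependent ℂ
      (fun p : (i : ι) × Fin (2 * d i + 1) => natG f v p.1 p.2) :=
    linearIndependent_strings (d := fun i => 2 * d i) t hv
      (fun i => by rw [hh]; push_cast; rfl) he
  have hcard : Fintype.card ((i : ι) × Fin (2 * d i + 1)) = ∑ i, (2 * d i + 1) := by
    simp [Fintype.card_sigma]
  exact ⟨he, hh, hli, hli.span_eq_top_of_card_eq_finrank'
    (le_antisymm hli.fintype_card_le_finrank (hcard ▸ hdim))⟩

lemma linearIndependent_of_weights {L : Type*} [LieRing L] [LieAlgebra ℂ L] {ι : Type*} {h : L}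
    {d : ι → ℕ} (hd : Function.Injective d) {v : ι → L}
    (hh : ∀ i, ⁅h, v i⁆ = (2 * (d i : ℂ)) • v i) (hv : ∀ i, v i ≠ 0) : LinearIndependent ℂ v := by
  refine Module.End.eigenvectors_linearIndependent' (LieAlgebra.ad ℂ L h)
    (fun i => 2 * (d i : ℂ)) (fun i j hij => hd ?_) v
    (fun i => ⟨Module.End.mem_eigenspace_iff.2 (hh i), hv i⟩)
  simpa using hij

/-- A skew matrix is determined by its entries below the diagonal. -/
lemma finrank_le_of_skew {V : Type*} [AddCommGroup V] [Module ℂ V] {N : ℕ}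
    (T : V →ₗ[ℂ] Matrix (Fin N) (Fin N) ℂ) (hT : Function.Injective T)
    (hskew : ∀ x, (T x)ᵀ = -T x) : 2 * Module.finrank ℂ V ≤ N * (N - 1) := by
  let r : V →ₗ[ℂ] (((i : Fin N) × Fin i) → ℂ) :=
    { toFun := fun x p => T x p.1 (Fin.castLE p.1.isLt.le p.2)
      map_add' := fun x y => by ext p; simp
      map_smul' := fun c x => by ext p; simp }
  have hr : Function.Injective r := by
    rw [injective_iff_map_eq_zero]
    intro x hx
    apply hT
    rw [map_zero]
    have hlt : ∀ i j : Fin N, j < i → T x i j = 0 := fun i j hij =>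
      congrFun hx ⟨i, ⟨j, hij⟩⟩
    have hsw : ∀ i j, T x j i = -T x i j := fun i j => congrFun (congrFun (hskew x) i) j
    ext i j
    rcases lt_trichotomy j i with h | h | h
    · exact hlt i j h
    · subst h
      have := hsw j j
      simp only [Matrix.zero_apply]
      linear_combination this / 2
    · rw [hsw j i, hlt j i h]
      simp
  have h1 := LinearMap.finrank_le_finrank_of_injective hr
  have h2 : Module.finrank ℂ (((i : Fin N) × Fin i) → ℂ) = ∑ i ∈ Finset.range N, i := by
    rw [Module.finrank_fintype_fun_eq_card, Fintype.card_sigma, Finset.sum_range]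
    simp
  rw [h2] at h1
  have h3 := Finset.sum_range_id_mul_two N
  omega

lemma sum_odd_dims (n : ℕ) :
    ∑ i : Fin (n - 1), (2 * (2 * (i : ℕ) + 1) + 1) = (n - 1) * (2 * n - 1) := by
  rcases n with _ | n
  · simp
  · rw [show n + 1 - 1 = n from rfl, show 2 * (n + 1) - 1 = 2 * n + 1 by omega,
      ← Finset.sum_range (fun i => 2 * (2 * i + 1) + 1)]
    induction n with
    | zero => simp
    | succ n ih => rw [Finset.sum_range_succ, ih]; ring

lemma sum_all_dims (N : ℕ) :
    ∑ i : Fin (N - 1), (2 * ((i : ℕ) + 1) + 1) = N ^ 2 - 1 := by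
  rcases N with _ | n
  · simp
  · rw [show n + 1 - 1 = n from rfl, ← Finset.sum_range (fun i => 2 * (i + 1) + 1)]
    have : ∑ i ∈ Finset.range n, (2 * (i + 1) + 1) + 1 = (n + 1) ^ 2 := by
      induction n with
      | zero => simp
      | succ n ih => rw [Finset.sum_range_succ, add_right_comm, ih]; ring
    omega

variable {N : ℕ}

lemma finrank_sl_le (hN : 1 ≤ N) :
    Module.finrank ℂ (LieAlgebra.SpecialLinear.sl (Fin N) ℂ) ≤ N ^ 2 - 1 := by
  have h := LinearMap.finrank_range_add_finrank_ker (Matrix.traceLinearMap (Fin N) ℂ ℂ)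
  have hr : 0 < Module.finrank ℂ (LinearMap.range (Matrix.traceLinearMap (Fin N) ℂ ℂ)) := by
    rw [Module.finrank_pos_iff_exists_ne_zero]
    refine ⟨⟨_, LinearMap.mem_range_self _ (1 : Matrix (Fin N) (Fin N) ℂ)⟩, fun h0 => ?_⟩
    have : ((N : ℕ) : ℂ) = 0 := by simpa using congrArg Subtype.val h0
    rw [Nat.cast_eq_zero] at this
    omega
  have hk : Module.finrank ℂ (LieAlgebra.SpecialLinear.sl (Fin N) ℂ) =
    Module.finrank ℂ (LinearMap.ker (Matrix.traceLinearMap (Fin N) ℂ ℂ)) := rfl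
  rw [Module.finrank_matrix] at h
  simp only [Fintype.card_fin, Module.finrank_self, mul_one] at h
  rw [hk, sq]
  omega

lemma lie_pow_eq_zero {K : LieSubalgebra ℂ (Matrix (Fin N) (Fin N) ℂ)} {e x : K} {k : ℕ}
    (hx : x.1 = e.1 ^ k) : ⁅e, x⁆ = 0 := by
  refine Subtype.ext ?_
  change e.1 * x.1 - x.1 * e.1 = 0
  rw [hx, ← pow_succ, ← pow_succ', sub_self]

lemma lie_h_pow_eq {K : LieSubalgebra ℂ (Matrix (Fin N) (Fin N) ℂ)} {h e f x : K} {k : ℕ}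
    (t : IsSl2Triple h e f) (hx : x.1 = e.1 ^ k) : ⁅h, x⁆ = (2 * (k : ℂ)) • x := by
  refine Subtype.ext ?_
  change h.1 * x.1 - x.1 * h.1 = (2 * (k : ℂ)) • x.1
  rw [hx, lie_pow_of_lie_eq_two (commutator_h_e t)]

theorem isNaturalBasis_sl {h e f : LieAlgebra.SpecialLinear.sl (Fin N) ℂ} (hN : 1 ≤ N)
    (t : IsSl2Triple h e f) (he : e.1 ^ (N - 1) ≠ 0) :
    IsNaturalBasis h e f (fun i : Fin (N - 1) => (i : ℕ) + 1) (slHighest t) := by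
  have hh : ∀ i : Fin (N - 1), ⁅h, slHighest t i⁆ =
      (2 * (((i : ℕ) + 1 : ℕ) : ℂ)) • slHighest t i := fun i => lie_h_pow_eq t rfl
  refine isNaturalBasis_of_finrank_le t
    (linearIndependent_of_weights (d := fun i : Fin (N - 1) => (i : ℕ) + 1)
      (fun i j hij => Fin.ext (by simpa using hij)) hh fun i h0 => he ?_)
    (fun i => lie_pow_eq_zero rfl) hh ?_
  · exact pow_eq_zero_of_le (by have := i.isLt; omega : (i : ℕ) + 1 ≤ N - 1)
      (congrArg Subtype.val h0)
  · rw [sum_all_dims]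
    exact finrank_sl_le hN

lemma linearIndependent_soOddPow {n : ℕ} {J : Matrix (Fin N) (Fin N) ℂ}
    {h e f : skewAdjointMatricesLieSubalgebra J}
    (t : IsSl2Triple h e f) (he : e.1 ^ (2 * n - 2) ≠ 0) :
    LinearIndependent ℂ (fun i : Fin (n - 1) => soOddPow e i) :=
  linearIndependent_of_weights (d := fun i : Fin (n - 1) => 2 * (i : ℕ) + 1)
    (fun i j hij => Fin.ext (by simpa using hij)) (fun i => lie_h_pow_eq t rfl) fun i h0 =>
      he (pow_eq_zero_of_le (by have := i.isLt; omega : 2 * (i : ℕ) + 1 ≤ 2 * n - 2)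
        (congrArg Subtype.val h0))

theorem isNaturalBasis_so {n : ℕ} {h e f : LieAlgebra.Orthogonal.so (Fin (2 * n - 1)) ℂ}
    (t : IsSl2Triple h e f) (he : e.1 ^ (2 * n - 2) ≠ 0) :
    IsNaturalBasis h e f (fun i : Fin (n - 1) => 2 * (i : ℕ) + 1) (fun i => soOddPow e i) := by
  refine isNaturalBasis_of_finrank_le t (linearIndependent_soOddPow t he)
    (fun i => lie_pow_eq_zero rfl) (fun i => lie_h_pow_eq t rfl) ?_
  rw [sum_odd_dims]
  have := finrank_le_of_skew (LieAlgebra.Orthogonal.so (Fin (2 * n - 1)) ℂ).subtype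
    Subtype.val_injective (fun x => (LieAlgebra.Orthogonal.mem_so _ _ _).1 x.2)
  rw [show 2 * n - 1 - 1 = 2 * (n - 1) by omega,
    show (2 * n - 1) * (2 * (n - 1)) = 2 * ((n - 1) * (2 * n - 1)) by ring] at this
  exact Nat.le_of_mul_le_mul_left this two_pos

/-- Left multiplication by the form turns skew-adjoint matrices into skew-symmetric ones. -/
lemma finrank_soD_le (n : ℕ) : Module.finrank ℂ (soD n) ≤ n * (2 * n - 1) := by
  have hJJ : antidiagForm (2 * n) * antidiagForm (2 * n) = 1 := by
    refine ext_iff_mulVec.2 fun x => funext fun i => ?_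
    rw [← mulVec_mulVec, antidiagForm_mulVec, antidiagForm_mulVec, Fin.rev_rev, one_mulVec]
  have := finrank_le_of_skew
    (LinearMap.mulLeft ℂ (antidiagForm (2 * n)) ∘ₗ (soD n).toSubmodule.subtype)
    (fun x y hxy => Subtype.ext (by
      have := congrArg (fun M => antidiagForm (2 * n) * M) hxy
      simpa [← mul_assoc, hJJ] using this))
    (fun x => by
      change (antidiagForm (2 * n) * x.1)ᵀ = -(antidiagForm (2 * n) * x.1)
      rw [transpose_mul, antidiagForm_transpose, soD_transpose_mul])
  rw [mul_assoc] at this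
  exact Nat.le_of_mul_le_mul_left this two_pos

/-- Pairs of elements of two Lie algebras of matrices that are intertwined by a matrix `P`. -/
def intertwined {M : ℕ} (K₁ : LieSubalgebra ℂ (Matrix (Fin M) (Fin M) ℂ))
    (K₂ : LieSubalgebra ℂ (Matrix (Fin N) (Fin N) ℂ)) (P : Matrix (Fin M) (Fin N) ℂ) :
    Submodule ℂ (K₁ × K₂) where
  carrier := {x | x.1.1 * P = P * x.2.1}
  add_mem' {x y} hx hy := by
    change (x.1.1 + y.1.1) * P = P * (x.2.1 + y.2.1)
    rw [Matrix.add_mul, Matrix.mul_add, show x.1.1 * P = _ from hx, show y.1.1 * P = _ from hy]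
  zero_mem' := by
    change (0 : Matrix (Fin M) (Fin M) ℂ) * P = P * (0 : Matrix (Fin N) (Fin N) ℂ)
    rw [Matrix.zero_mul, Matrix.mul_zero]
  smul_mem' c x hx := by
    change (c • x.1.1) * P = P * (c • x.2.1)
    rw [Matrix.smul_mul, Matrix.mul_smul, show x.1.1 * P = _ from hx]

/-! ### Closure properties of the intertwining relation -/

section Intertwined

variable {M : ℕ} {K₁ : LieSubalgebra ℂ (Matrix (Fin M) (Fin M) ℂ)}
  {K₂ : LieSubalgebra ℂ (Matrix (Fin N) (Fin N) ℂ)} {P : Matrix (Fin M) (Fin N) ℂ}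

lemma mem_intertwined {x : K₁ × K₂} : x ∈ intertwined K₁ K₂ P ↔ x.1.1 * P = P * x.2.1 := Iff.rfl

lemma lie_mem_intertwined : ∀ x ∈ intertwined K₁ K₂ P, ∀ y ∈ intertwined K₁ K₂ P,
    (⁅x.1, y.1⁆, ⁅x.2, y.2⁆) ∈ intertwined K₁ K₂ P := by
  intro x hx y hy
  rw [mem_intertwined] at hx hy
  change (x.1.1 * y.1.1 - y.1.1 * x.1.1) * P = P * (x.2.1 * y.2.1 - y.2.1 * x.2.1)
  rw [Matrix.sub_mul, Matrix.mul_sub, Matrix.mul_assoc, hy, ← Matrix.mul_assoc, hx,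
    Matrix.mul_assoc, Matrix.mul_assoc y.1.1, hx, ← Matrix.mul_assoc y.1.1, hy, Matrix.mul_assoc]

lemma eq_zero_of_mem_intertwined (hP : Function.Injective P.mulVec) (y : K₂)
    (hy : ((0 : K₁), y) ∈ intertwined K₁ K₂ P) : y = 0 := by
  have h0 : P * y.1 = 0 := by
    rw [← mem_intertwined.1 hy]
    change (0 : Matrix (Fin M) (Fin M) ℂ) * P = 0
    rw [Matrix.zero_mul]
  refine Subtype.ext (ext_iff_mulVec.2 fun x => hP ?_)
  rw [mulVec_mulVec, h0, zero_mulVec]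
  change 0 = P *ᵥ ((0 : Matrix (Fin N) (Fin N) ℂ) *ᵥ x)
  simp

lemma pow_mul_intertwined {e : Matrix (Fin M) (Fin M) ℂ} {e' : Matrix (Fin N) (Fin N) ℂ}
    (h : e * P = P * e') (k : ℕ) : e ^ k * P = P * e' ^ k := by
  induction k with
  | zero => rw [pow_zero, pow_zero, Matrix.one_mul, Matrix.mul_one]
  | succ k ih => rw [pow_succ, pow_succ, Matrix.mul_assoc, h, ← Matrix.mul_assoc, ih,
      Matrix.mul_assoc]

end Intertwined

section TypeDBasis

variable {n : ℕ} {H E : soD n}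

/-- The sign by which the reflection acts on a summand. -/
def dSign : DIndex n → ℂ
  | some _ => 1
  | none => -1

/-- Commuting or anticommuting with `R` means that `(X, X)` or `(X, -X)` is intertwined. The sign of
`S` is inherited along its string because `E` commutes with `R`. -/
lemma exists_reflection_intertwined (hn : 2 ≤ n) (t : IsSl2Triple H E (dF n)) (z : ℂ) :
    ∃ R : Matrix (Fin (2 * n)) (Fin (2 * n)) ℂ, Function.Injective R.mulVec ∧
      (dF n, dF n) ∈ intertwined (soD n) (soD n) R ∧
      ∀ i, (dHighest hn E z i, dSign i • dHighest hn E z i) ∈ intertwined (soD n) (soD n) R := by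
  obtain ⟨R, hRR, hE, hF, hS, -, -⟩ := exists_reflection hn t
  refine ⟨R, fun x y hxy => ?_, hF, fun i => ?_⟩
  · have := congrArg (fun x => R *ᵥ x) hxy
    simpa [mulVec_mulVec, hRR] using this
  · cases i with
    | some i =>
      rw [dSign, one_smul]
      exact pow_mul_intertwined hE _
    | none =>
      have key : ∀ k, (((LieAlgebra.ad ℂ (soD n) E) ^ k) (dS hn),
          -((LieAlgebra.ad ℂ (soD n) E) ^ k) (dS hn)) ∈ intertwined (soD n) (soD n) R := by
        intro k
        induction k with
        | zero => exact hS
        | succ k ih =>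
          have := lie_mem_intertwined (E, E) hE _ ih
          rw [pow_succ', Module.End.mul_apply, LieAlgebra.ad_apply]
          rwa [lie_neg] at this
      have := (intertwined (soD n) (soD n) R).smul_mem z (key (2 * n - 2))
      rw [dSign, neg_one_smul]
      simp only [dHighest]
      rwa [Prod.smul_mk, smul_neg] at this

lemma dHighest_none (hn : 2 ≤ n) (t : IsSl2Triple H E (dF n)) {z : ℂ} :
    (z ≠ 0 → dHighest hn E z none ≠ 0) ∧
    ⁅H, dHighest hn E z none⁆ = (2 * ((n - 1 : ℕ) : ℂ)) • dHighest hn E z none ∧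
    ⁅E, dHighest hn E z none⁆ = 0 := by
  obtain ⟨-, -, -, -, -, hHS, hFS⟩ := exists_reflection hn t
  have hS0 : dS hn ≠ 0 := by
    intro h0
    have := congrFun (congrFun (congrArg Subtype.val h0) ⟨n - 1, by omega⟩) ⟨0, by omega⟩
    simp [dS, dSMatrix, show n - 1 + 1 = n by omega] at this
  obtain ⟨h1, h2, h3⟩ := highest_of_lowest t hS0 hHS hFS
  have hw : ((2 * n - 2 : ℕ) : ℂ) = 2 * ((n - 1 : ℕ) : ℂ) := by
    rw [show 2 * n - 2 = 2 * (n - 1) by omega]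
    push_cast
    ring
  refine ⟨fun hz => smul_ne_zero hz h1, ?_, ?_⟩
  · rw [dHighest, lie_smul, ← hw, smul_comm]
    exact congrArg _ h2
  · rw [dHighest, lie_smul]
    exact (congrArg _ h3).trans (smul_zero _)

/-- The last basis vector is a lowest weight vector of weight `-(2n - 2)`, so `E` raises it `2n - 2`
times without killing it. -/
theorem exists_highest_soD (hn : 2 ≤ n) (t : IsSl2Triple H E (dF n)) :
    ∃ v : Fin (2 * n) → ℂ, v ≠ 0 ∧ H.1 *ᵥ v = ((2 * n - 2 : ℕ) : ℂ) • v ∧ E.1 *ᵥ v = 0 ∧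
      E.1 ^ (2 * n - 2) ≠ 0 := by
  have hlast := mulVec_dLastVec hn t
  have hl0 : dLastVec hn ≠ 0 := by
    intro h0
    have := congrFun h0 ⟨2 * n - 1, by omega⟩
    simp [dLastVec] at this
  obtain ⟨h1, h2, h3⟩ := highest_of_lowest (isSl2Triple_toLin' (isSl2Triple_val t))
    (v := dLastVec hn) (n := 2 * n - 2) hl0 hlast (dFMatrix_mulVec_dLastVec hn)
  refine ⟨_, h1, h2, h3, fun h0 => h1 ?_⟩
  rw [LieModule.toEnd_module_end, LieHom.id_apply, ← toLin'_pow, h0]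
  simp

/-- Weights alone do not separate the highest weight vectors: for even `n` the summands `V_{n-1}`
and `V_{n'}` share a weight. The reflection does, fixing odd powers of `E` and negating the extra
vector. -/
theorem isNaturalBasis_soD (hn : 2 ≤ n) (t : IsSl2Triple H E (dF n)) {z : ℂ} (hz : z ≠ 0) :
    IsNaturalBasis H E (dF n) (dDeg n) (dHighest hn E z) := by
  obtain ⟨-, -, -, -, hE⟩ := exists_highest_soD hn t
  obtain ⟨hne, hh, he⟩ := dHighest_none hn t (z := z)
  obtain ⟨R, hR, -, hRv⟩ := exists_reflection_intertwined hn t z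
  refine isNaturalBasis_of_finrank_le t (linearIndependent_option.2 ⟨?_, fun hmem => hne hz ?_⟩)
    (fun i => ?_) (fun i => ?_) ?_
  · exact linearIndependent_soOddPow t hE
  · have hfix : ∀ x ∈ Submodule.span ℂ (Set.range (dHighest hn E z ∘ some)),
        (x, x) ∈ intertwined (soD n) (soD n) R := by
      intro x hx
      induction hx using Submodule.span_induction with
      | mem x hx =>
        obtain ⟨i, rfl⟩ := hx
        have := hRv (some i)
        rwa [dSign, one_smul] at this
      | zero => exact Submodule.zero_mem _
      | add x y _ _ hx hy => exact Submodule.add_mem _ hx hy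
      | smul c x _ hx => exact Submodule.smul_mem _ c hx
    have h1 := Submodule.sub_mem _ (hfix _ hmem) (hRv none)
    rw [Prod.mk_sub_mk, sub_self] at h1
    have h2 := eq_zero_of_mem_intertwined hR _ h1
    rw [dSign, neg_one_smul, sub_neg_eq_add, ← two_smul ℂ] at h2
    exact (smul_eq_zero.1 h2).resolve_left two_ne_zero
  · cases i with
    | some i => exact lie_pow_eq_zero rfl
    | none => exact he
  · cases i with
    | some i => exact lie_h_pow_eq t rfl
    | none => exact hh
  · refine (finrank_soD_le n).trans (le_of_eq ?_)
    rw [Fintype.sum_option]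
    change _ = 2 * (n - 1) + 1 + ∑ i : Fin (n - 1), (2 * (2 * (i : ℕ) + 1) + 1)
    rw [sum_odd_dims]
    obtain ⟨k, rfl⟩ := Nat.exists_eq_add_of_le hn
    rw [show 2 + k - 1 = k + 1 by omega, show 2 * (2 + k) - 1 = 2 * k + 3 by omega]
    ring

end TypeDBasis

end NaturalBases

/-! ### The comparison theorem -/

/-- Comparison of structure constants of Lie algebras of matrices along an intertwiner between
natural representations. -/
theorem IsStructureConstants.eq_of_intertwiner {M N : ℕ}
    {K₁ : LieSubalgebra ℂ (Matrix (Fin M) (Fin M) ℂ)}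
    {K₂ : LieSubalgebra ℂ (Matrix (Fin N) (Fin N) ℂ)} {ι₁ ι₂ κ : Type*} [Fintype ι₁] [Fintype ι₂]
    [Fintype κ] {h₁ e₁ f₁ : K₁} {d₁ : ι₁ → ℕ} {v₁ : ι₁ → K₁} {ω₁ : ι₁ → ι₁ → ι₁ → ℂ}
    {h₂ e₂ f₂ : K₂} {d₂ : ι₂ → ℕ} {v₂ : ι₂ → K₂} {ω₂ : ι₂ → ι₂ → ι₂ → ℂ}
    (H₁ : IsStructureConstants h₁ e₁ f₁ d₁ v₁ ω₁) (H₂ : IsStructureConstants h₂ e₂ f₂ d₂ v₂ ω₂)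
    (t₁ : IsSl2Triple h₁ e₁ f₁) (t₂ : IsSl2Triple h₂ e₂ f₂) {s : ℕ} (hN : N = s + 1)
    (hv₁ : ∃ v, v ≠ 0 ∧ h₁.1.mulVec v = (s : ℂ) • v ∧ e₁.1.mulVec v = 0)
    (he₂ : e₂.1 ^ s ≠ 0)
    (σ₁ : κ → ι₁) (hσ₁ : Function.Injective σ₁) (σ₂ : κ → ι₂) (hσ₂ : Function.Injective σ₂)
    (hd : ∀ i, d₁ (σ₁ i) = d₂ (σ₂ i)) (p : κ → ℕ) (hp₁ : ∀ i, (v₁ (σ₁ i)).1 = e₁.1 ^ p i)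
    (hp₂ : ∀ i, (v₂ (σ₂ i)).1 = e₂.1 ^ p i)
    (hoff : ∀ i j c, c ∉ Set.range σ₁ → ω₁ (σ₁ i) (σ₁ j) c = 0) (i j k : κ) :
    ω₁ (σ₁ i) (σ₁ j) (σ₁ k) = ω₂ (σ₂ i) (σ₂ j) (σ₂ k) := by
  obtain ⟨v₁, hv0, hvh, hve⟩ := hv₁
  obtain ⟨v₂, hv0', hvh', hve'⟩ := exists_highest_of_pow_ne_zero (isSl2Triple_val t₂) hN he₂
  -- The natural module of `K₂` has dimension `s + 1` and highest weight `s`, so it is a single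
  -- string and embeds in that of `K₁`.
  obtain ⟨P, hP, hPe, hPf⟩ := exists_intertwiner (isSl2Triple_val t₂) (isSl2Triple_val t₁) hN
    hv0' hvh' hve' hv0 hvh hve
  have := H₁.eq_of_correspondence H₂ t₂ (intertwined K₁ K₂ P) lie_mem_intertwined
    (eq_zero_of_mem_intertwined hP) σ₁ hσ₁ σ₂ hσ₂ hd (fun _ => 1) hPf
    (fun i => by
      rw [one_smul, mem_intertwined, hp₁, hp₂]
      exact pow_mul_intertwined hPe _) hoff i j k
  simpa using this.symm

/-- The last index of each constant names the target summand. The three degrees in the final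
equalities are odd, so the transvectant, when defined, automatically has odd order. -/
theorem mainTheorem9 (n : ℕ) (hn : 2 ≤ n)
    (HD ED : soD n) (hD : IsSl2Triple HD ED (dF n)) (z : ℂ) (hz : z ≠ 0)
    (HB EB FB : LieAlgebra.Orthogonal.so (Fin (2 * n - 1)) ℂ)
    (hB : IsPrincipalSl2Triple (n - 1) HB EB FB)
    (HA EA FA : LieAlgebra.SpecialLinear.sl (Fin (2 * n - 1)) ℂ)
    (hA : IsPrincipalSl2Triple (2 * n - 2) HA EA FA) :
    ∃ (ωD : DIndex n → DIndex n → DIndex n → ℂ)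
      (ωB : Fin (n - 1) → Fin (n - 1) → Fin (n - 1) → ℂ)
      (ωA : Fin (2 * n - 1 - 1) → Fin (2 * n - 1 - 1) → Fin (2 * n - 1 - 1) → ℂ),
      (∀ ω, IsStructureConstants HD ED (dF n) (dDeg n) (dHighest hn ED z) ω ↔ ω = ωD) ∧
      (∀ ω, IsStructureConstants HB EB FB (fun i : Fin (n - 1) => 2 * (i : ℕ) + 1)
        (fun i => soOddPow EB i) ω ↔ ω = ωB) ∧
      (∀ ω, IsStructureConstants HA EA FA (fun i : Fin (2 * n - 1 - 1) => (i : ℕ) + 1)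
        (slHighest hA.triple) ω ↔ ω = ωA) ∧
      (∀ k l : Fin (n - 1), ωD (some k) (some l) none = 0) ∧
      (∀ k m : Fin (n - 1), ωD (some k) none (some m) = 0) ∧
      ωD none none none = 0 ∧
      ∀ k l m : Fin (n - 1),
        ωD (some k) (some l) (some m) = ωB k l m ∧
        ωB k l m = ωA ⟨2 * (k : ℕ), by have := k.isLt; omega⟩
          ⟨2 * (l : ℕ), by have := l.isLt; omega⟩ ⟨2 * (m : ℕ), by have := m.isLt; omega⟩ := by
  have hsize : 2 * n - 1 = 2 * n - 2 + 1 := by omega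
  have heA : EA.1 ^ (2 * n - 2) ≠ 0 :=
    pow_ne_zero_of_isPrincipal_sl (N := 2 * n - 1) (by omega) hA
  have heB : EB.1 ^ (2 * n - 2) ≠ 0 := pow_ne_zero_of_isPrincipal_so hn hB
  obtain ⟨vD, hvD, hvDh, hvDe, -⟩ := exists_highest_soD hn hD
  obtain ⟨ωD, hωD⟩ := (isNaturalBasis_soD hn hD hz).exists_structureConstants hD
  obtain ⟨ωB, hωB⟩ := (isNaturalBasis_so hB.triple heB).exists_structureConstants hB.triple
  obtain ⟨ωA, hωA⟩ :=
    (isNaturalBasis_sl (by omega) hA.triple heA).exists_structureConstants hA.triple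
  have HωD := (hωD ωD).2 rfl
  have HωB := (hωB ωB).2 rfl
  have HωA := (hωA ωA).2 rfl
  obtain ⟨R, hR, hRf, hRv⟩ := exists_reflection_intertwined hn hD z
  -- Comparing `so_{2n}` with itself along the reflection multiplies each constant by the product of
  -- three signs.
  have hsign := HωD.eq_of_correspondence HωD hD (intertwined (soD n) (soD n) R) lie_mem_intertwined
    (eq_zero_of_mem_intertwined hR) id Function.injective_id id Function.injective_id
    (fun _ => rfl) dSign hRf hRv (fun i j c hc => absurd ⟨c, rfl⟩ hc)
  simp only [id] at hsign
  have h1 : ∀ k l : Fin (n - 1), ωD (some k) (some l) none = 0 := fun k l => by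
    have := hsign (some k) (some l) none
    simp only [dSign] at this
    linear_combination this / 2
  have h2 : ∀ k m : Fin (n - 1), ωD (some k) none (some m) = 0 := fun k m => by
    have := hsign (some k) none (some m)
    simp only [dSign] at this
    linear_combination -this / 2
  have h3 : ωD none none none = 0 := by
    have := hsign none none none
    simp only [dSign] at this
    linear_combination this / 2
  -- The degree `2k + 1` sits at position `2k` among the degrees `1, 2, …` of `sl_{2n-1}`.
  let σ : Fin (n - 1) → Fin (2 * n - 1 - 1) :=
    fun k => ⟨2 * (k : ℕ), by have := k.isLt; omega⟩
  have hσ : Function.Injective σ := fun a b hab => Fin.ext (by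
    have := congrArg Fin.val hab
    simp only [σ] at this
    omega)
  have hDA : ∀ k l m, ωD (some k) (some l) (some m) = ωA (σ k) (σ l) (σ m) :=
    HωD.eq_of_intertwiner HωA hD hA.triple hsize ⟨vD, hvD, hvDh, hvDe⟩ heA some
      (Option.some_injective _) σ hσ (fun i => rfl) (fun i => 2 * (i : ℕ) + 1) (fun i => rfl)
      (fun i => rfl) (fun i j c hc => by
        cases c with
        | none => exact h1 i j
        | some c => exact absurd ⟨c, rfl⟩ hc)
  have hBA : ∀ k l m, ωB k l m = ωA (σ k) (σ l) (σ m) :=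
    HωB.eq_of_intertwiner HωA hB.triple hA.triple hsize
      (exists_highest_of_pow_ne_zero (isSl2Triple_val hB.triple) hsize heB) heA id
      Function.injective_id σ hσ (fun i => rfl) (fun i => 2 * (i : ℕ) + 1) (fun i => rfl)
      (fun i => rfl) (fun i j c hc => absurd ⟨c, rfl⟩ hc)
  exact ⟨ωD, ωB, ωA, hωD, hωB, hωA, h1, h2, h3, fun k l m =>
    ⟨(hDA k l m).trans (hBA k l m).symm, hBA k l m⟩⟩
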